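/- Let $\Bbbk$ be an algebraically closed field of characteristic zero and let $R=\Bbbk[x_0,x_1,x_2]$ be the homogeneous coordinate ring of $\mathbb P^2=\mathbb P^2_{\Bbbk}$. For integers $1\le d_1<\dots<d_s$, the standard $\Bbbk$-configuration of type $(d_1,\dots,d_s)$ is the set of points $$\{[1:j:s-i]\ :\ 1\le i\le s,\ 0\le j\le d_i-1\}\subseteq\mathbb P^2 .$$ For a homogeneous ideal $I\subseteq R$ let $I^{(t)}=\bigcap_{P\in \mathrm{Ass}(R/I)}(I^tR_P\cap R)$ be its $t$-th symbolic power, let $\alpha(I)$ be the least degree of a nonzero form in $I$, and let $\widehat\alpha(I)=\lim_{t\to\infty}\alpha(I^{(t)})/t$ be its Waldschmidt constant. Theorem. Let $\mathbb X$ be the standard $\Bbbk$-configuration of type $(1,b,2b-1)$, where $1<b<2b-1$ (that is, $b\ge 2$), and let $I_{\mathbb X}\subseteq R$ be its homogeneous ideal. Then the limit defining $\widehat\alpha(I_{\mathbb X})$ exists and $$\widehat\alpha(I_{\mathbb X})=\frac{6b^2-8b+1}{2b^2-2b}.$$ -/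

import Mathlib

open Filter Topology
open scoped LinearAlgebra.Projectivization

noncomputable section

namespace KConfiguration

/-- The `t`-th symbolic power `I^(t) = ⋂_{P ∈ Ass(R/I)} (I^t R_P ∩ R)` of an ideal `I` of a
commutative ring `R`; `Submodule.associatedPrimes I` is the set of associated primes of `R/I`. -/
def symbolicPower {R : Type*} [CommRing R] (I : Ideal R) (t : ℕ) : Ideal R :=
  ⨅ (P : Ideal R) (hP : P ∈ Submodule.associatedPrimes I),
    haveI : P.IsPrime := hP.toIsPrime
    ((I ^ t).map (algebraMap R (Localization.AtPrime P))).comap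
      (algebraMap R (Localization.AtPrime P))

/-- The initial degree `α(I)`: the least degree of a nonzero form in `I`
(with the value `0` if there is none). -/
def initialDegree {σ K : Type*} [Field K] (I : Ideal (MvPolynomial σ K)) : ℕ :=
  sInf {d : ℕ | ∃ f ∈ I, f ≠ 0 ∧ f.IsHomogeneous d}

/-- `w` is the Waldschmidt constant of `I`: the sequence `α(I^(t)) / t` converges to `w`
as `t` tends to infinity. -/
def IsWaldschmidtConstant {σ K : Type*} [Field K] (I : Ideal (MvPolynomial σ K)) (w : ℝ) : Prop :=
  Tendsto (fun t : ℕ => (initialDegree (symbolicPower I t) : ℝ) / (t : ℝ)) atTop (𝓝 w)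

/-- The ideal `I_X ⊆ K[x₀, x₁, x₂]` of a set `X` of points of the projective plane: the polynomials
that vanish at all homogeneous coordinates of all points of `X`. -/
def pointsIdeal {K : Type*} [Field K] (X : Set (ℙ K (Fin 3 → K))) :
    Ideal (MvPolynomial (Fin 3) K) :=
  MvPolynomial.vanishingIdeal K
    {v : Fin 3 → K | ∃ hv : v ≠ 0, Projectivization.mk K v hv ∈ X}

theorem affine_ne_zero {K : Type*} [Field K] (x y : K) : (![1, x, y] : Fin 3 → K) ≠ 0 :=
  fun h => one_ne_zero (congrFun h 0)

/-- The point `[1 : x : y]` of the projective plane. -/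
def affinePoint {K : Type*} [Field K] (x y : K) : ℙ K (Fin 3 → K) :=
  Projectivization.mk K ![1, x, y] (affine_ne_zero x y)

/-- `X` is the standard `k`-configuration of type `(d₁, …, d_s)`, where `1 ≤ d₁ < ⋯ < d_s`: it
consists of the points `[1 : j : s - i]` with `1 ≤ i ≤ s` and `0 ≤ j ≤ d_i - 1`
(below, the index `i` starts from `0`). -/
def IsStandardConfiguration (K : Type*) [Field K] {s : ℕ} (d : Fin s → ℕ)
    (X : Set (ℙ K (Fin 3 → K))) : Prop :=
  (∀ i, 1 ≤ d i) ∧ StrictMono d ∧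
    X = {P | ∃ (i : Fin s) (j : ℕ), j < d i ∧
      P = affinePoint (j : K) ((s - 1 - (i : ℕ) : ℕ) : K)}

end KConfiguration

end

/-! Put `n = b - 1`, `T = 2n(n+1)`, `D = 6n² + 4n - 1`; the claimed value is `D / T`. The projection
`x₁ / (2x₀ - x₂)` from the top point sends a middle point and an even bottom point to each `a i`,
and the odd bottom points to the other values `k j`.

Upper bound: `extremalForm` has degree `D` and multiplicity at least `T` at every point, and its
powers bound `α(I^(t))` from above.

Lower bound: Bézout against rational curves of degree at most `T` whose orders at the points add up
to `D`: `T - (2n+1)` at the top, `2n` at each middle point, `1` at each even point, and `2n+1` at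
each odd point except one, where it is `2n`. Such a curve can be made to avoid lying in `f = 0` for
any given nonzero form `f` (`exists_curve`). If `f` lies in `I^(t)` and has degree `d`, its pullback
has degree at most `dT` and is divisible by the `t`-th powers of coprime polynomials of total degree
`D`, so `Dt ≤ dT` (`mul_le_degree_of_mem_symbolicPower`).

The curve is `[W + V : 2U : 2V]`, with projection `U / W = X + E² / H`, where `E = ∏ (X - a i)` and
`H` has degree `2n+1`. Its fiber over `a i` splits as `(X - a i) M_i`: the root `a i` is sent to the
even point, the roots of `M_i` to the middle point. This is achieved by `V = E ∏ F_(k j)`, with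
`F_x` the fiber polynomial, and `W = V - ∏ M_i`, because the bottom row is `V = 0` and the middle
row is `V = W`. Modulo `H` both terms of `W` are `E^(2n+1)`, so `W = H G` (`dvd_curveDenom`), and
the roots of `G` are sent to the top point. -/

namespace KConfiguration

/-! ### Symbolic powers of a finite intersection of incomparable primes. -/

section SymbolicPowers

variable {R ι : Type*} [CommRing R] [Finite ι]

theorem exists_notMem_of_incomparable {p : ι → Ideal R} [∀ i, (p i).IsPrime]
    (hp : ∀ i j, i ≠ j → ¬ p i ≤ p j) (i : ι) :
    ∃ s, s ∉ p i ∧ ∀ j, j ≠ i → s ∈ p j := by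
  classical
  cases nonempty_fintype ι
  have h : ¬ (Finset.univ.erase i).inf p ≤ p i := by
    intro h
    obtain ⟨j, hj, hji⟩ := (Ideal.IsPrime.inf_le' inferInstance).1 h
    exact hp j i (Finset.ne_of_mem_erase hj) hji
  obtain ⟨s, hs, hsi⟩ := SetLike.not_le_iff_exists.1 h
  refine ⟨s, hsi, fun j hj => ?_⟩
  exact (Finset.inf_le (Finset.mem_erase.2 ⟨hj, Finset.mem_univ j⟩) : _ ≤ p j) hs

theorem mem_associatedPrimes_iInf {p : ι → Ideal R} [∀ i, (p i).IsPrime]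
    (hp : ∀ i j, i ≠ j → ¬ p i ≤ p j) (i : ι) :
    p i ∈ Submodule.associatedPrimes (⨅ i, p i) := by
  obtain ⟨s, hs, hs'⟩ := exists_notMem_of_incomparable hp i
  refine ⟨inferInstance, s, ?_⟩
  have h : Submodule.colon (⨅ i, p i) {s} = p i := by
    ext r
    rw [Submodule.mem_colon_singleton, smul_eq_mul, Submodule.mem_iInf]
    constructor
    · intro h
      exact ((inferInstance : (p i).IsPrime).mem_or_mem (h i)).resolve_right hs
    · intro h j
      by_cases hj : j = i
      · subst hj; exact Ideal.mul_mem_right _ _ h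
      · exact Ideal.mul_mem_left _ _ (hs' j hj)
  rw [h, (inferInstance : (p i).IsPrime).radical]

/-- The colon ideal of the intersection by `s` is the intersection of those `p i` that do not
contain `s`; a prime equal to its radical must be one of them. -/
theorem exists_eq_of_mem_associatedPrimes_iInf {p : ι → Ideal R} [∀ i, (p i).IsPrime]
    {P : Ideal R} (hP : P ∈ Submodule.associatedPrimes (⨅ i, p i)) : ∃ i, P = p i := by
  classical
  cases nonempty_fintype ι
  obtain ⟨hprime, s, hs⟩ := hP
  have hle : ∀ i, s ∉ p i → P ≤ p i := by
    intro i hi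
    rw [hs]
    refine (Ideal.IsPrime.radical_le_iff inferInstance).2 fun r hr => ?_
    rw [Submodule.mem_colon_singleton, smul_eq_mul, Submodule.mem_iInf] at hr
    exact ((inferInstance : (p i).IsPrime).mem_or_mem (hr i)).resolve_right hi
  have h : (Finset.univ.filter fun i => s ∉ p i).inf p ≤ P := by
    intro r hr
    rw [hs]
    refine Ideal.le_radical ?_
    rw [Submodule.mem_colon_singleton, smul_eq_mul, Submodule.mem_iInf]
    intro i
    by_cases hi : s ∈ p i
    · exact Ideal.mul_mem_left _ _ hi
    · refine Ideal.mul_mem_right _ _ ?_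
      exact (Finset.inf_le (Finset.mem_filter.2 ⟨Finset.mem_univ i, hi⟩) : _ ≤ p i) hr
  obtain ⟨i, hi, hiP⟩ := (Ideal.IsPrime.inf_le' hprime).1 h
  exact ⟨i, le_antisymm (hle i (Finset.mem_filter.1 hi).2) hiP⟩

theorem mem_comap_map_atPrime_iff {I P : Ideal R} [P.IsPrime] {f : R} :
    f ∈ (I.map (algebraMap R (Localization.AtPrime P))).comap
      (algebraMap R (Localization.AtPrime P)) ↔ ∃ s, s ∉ P ∧ s * f ∈ I := by
  rw [Ideal.mem_comap, IsLocalization.algebraMap_mem_map_algebraMap_iff P.primeCompl]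
  rfl

/-- If `s` avoids `p i` and lies in all the other primes, then `s · p i` is contained in the
intersection, so `s ^ t` clears the denominators at `p i`. -/
theorem mem_symbolicPower_iInf {p : ι → Ideal R} [∀ i, (p i).IsPrime]
    (hp : ∀ i j, i ≠ j → ¬ p i ≤ p j) {t : ℕ} {f : R} (hf : ∀ i, f ∈ p i ^ t) :
    f ∈ symbolicPower (⨅ i, p i) t := by
  unfold symbolicPower
  simp only [Submodule.mem_iInf]
  intro P hP
  obtain ⟨i, rfl⟩ := exists_eq_of_mem_associatedPrimes_iInf hP
  rw [mem_comap_map_atPrime_iff]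
  obtain ⟨s, hs, hs'⟩ := exists_notMem_of_incomparable hp i
  refine ⟨s ^ t, fun h => hs ((inferInstance : (p i).IsPrime).mem_of_pow_mem t h), ?_⟩
  have h : Ideal.span {s} * p i ≤ ⨅ i, p i := by
    rw [Ideal.span_singleton_mul_le_iff]
    intro r hr
    rw [Submodule.mem_iInf]
    intro j
    by_cases hj : j = i
    · subst hj; exact Ideal.mul_mem_left _ _ hr
    · exact Ideal.mul_mem_right _ _ (hs' j hj)
  refine Ideal.pow_right_mono h t ?_
  rw [mul_pow, Ideal.span_singleton_pow]
  exact Ideal.mul_mem_mul (Ideal.mem_span_singleton_self _) (hf i)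

/-- The multiplier `s` need not be removed: `pow_dvd_aeval_of_mul_mem_pow` tolerates it. -/
theorem exists_mul_mem_pow_of_mem_symbolicPower_iInf {p : ι → Ideal R} [∀ i, (p i).IsPrime]
    (hp : ∀ i j, i ≠ j → ¬ p i ≤ p j) {t : ℕ} {f : R}
    (hf : f ∈ symbolicPower (⨅ i, p i) t) (i : ι) : ∃ s, s ∉ p i ∧ s * f ∈ p i ^ t := by
  unfold symbolicPower at hf
  simp only [Submodule.mem_iInf] at hf
  obtain ⟨s, hs, hsf⟩ := mem_comap_map_atPrime_iff.1 (hf (p i) (mem_associatedPrimes_iInf hp i))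
  exact ⟨s, hs, Ideal.pow_right_mono (iInf_le _ i) t hsf⟩

end SymbolicPowers

/-! ### Ideals of points and their pullback to a parametrized curve. -/

section LineIdeal

open Polynomial

variable {K : Type*} [Field K]

/-- The ideal of the polynomials vanishing on the line through the origin spanned by `v`. -/
noncomputable def lineIdeal {σ : Type*} (v : σ → K) : Ideal (MvPolynomial σ K) :=
  RingHom.ker (MvPolynomial.aeval (fun i => C (v i) * X : σ → K[X]))

instance {σ : Type*} (v : σ → K) : (lineIdeal v).IsPrime :=
  RingHom.ker_isPrime _

theorem eval_aeval_mvPolynomial {σ : Type*} (φ : σ → K[X]) (f : MvPolynomial σ K) (r : K) :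
    (MvPolynomial.aeval φ f).eval r = MvPolynomial.eval (fun i => (φ i).eval r) f := by
  induction f using MvPolynomial.induction_on with
  | C a => simp
  | add p q hp hq => rw [map_add, eval_add, hp, hq, map_add]
  | mul_X p i hp => rw [map_mul, eval_mul, hp, map_mul, MvPolynomial.aeval_X, MvPolynomial.eval_X]

theorem aeval_mul_left_of_isHomogeneous {σ A : Type*} [CommRing A] [Algebra K A] (r : A)
    (x : σ → A) {f : MvPolynomial σ K} {d : ℕ} (hf : f.IsHomogeneous d) :
    MvPolynomial.aeval (fun i => r * x i) f = r ^ d * MvPolynomial.aeval x f := by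
  rw [MvPolynomial.aeval_def, MvPolynomial.aeval_def, MvPolynomial.eval₂_eq,
    MvPolynomial.eval₂_eq, Finset.mul_sum]
  refine Finset.sum_congr rfl fun m hm => ?_
  have hm' : m.degree = d := by
    rw [Finsupp.degree_eq_weight_one]
    exact hf (MvPolynomial.mem_support_iff.1 hm)
  rw [Finsupp.degree_apply] at hm'
  simp_rw [mul_pow]
  rw [Finset.prod_mul_distrib, Finset.prod_pow_eq_pow_sum, hm']
  ring

theorem natDegree_aeval_le_of_isHomogeneous {σ : Type*} {φ : σ → K[X]} {e d : ℕ}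
    (hφ : ∀ i, (φ i).natDegree ≤ e) {f : MvPolynomial σ K} (hf : f.IsHomogeneous d) :
    (MvPolynomial.aeval φ f).natDegree ≤ d * e := by
  rw [MvPolynomial.aeval_def, MvPolynomial.eval₂_eq]
  refine natDegree_sum_le_of_forall_le _ _ fun m hm => ?_
  have hm' : m.degree = d := by
    rw [Finsupp.degree_eq_weight_one]
    exact hf (MvPolynomial.mem_support_iff.1 hm)
  rw [Finsupp.degree_apply] at hm'
  refine (natDegree_C_mul_le _ _).trans ((natDegree_prod_le _ _).trans ?_)
  rw [← hm', Finset.sum_mul]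
  exact Finset.sum_le_sum fun i _ => natDegree_pow_le.trans (Nat.mul_le_mul_left _ (hφ i))

/-- The value `c = 0` can be omitted because a nonzero polynomial has finitely many roots. This
matches `pointsIdeal`, which only tests nonzero coordinate vectors. -/
theorem mem_lineIdeal_iff [Infinite K] {σ : Type*} {v : σ → K} {f : MvPolynomial σ K} :
    f ∈ lineIdeal v ↔ ∀ c : K, c ≠ 0 → MvPolynomial.eval (c • v) f = 0 := by
  have key : ∀ c : K, (MvPolynomial.aeval (fun i => C (v i) * X : σ → K[X]) f).eval c =
      MvPolynomial.eval (c • v) f := by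
    intro c
    rw [eval_aeval_mvPolynomial]
    congr 2
    ext i
    rw [eval_mul, eval_C, eval_X, Pi.smul_apply, smul_eq_mul, mul_comm]
  rw [lineIdeal, RingHom.mem_ker]
  constructor
  · intro h c _
    rw [← key, h, eval_zero]
  · intro h
    refine eq_zero_of_infinite_isRoot _ (Set.Infinite.mono (s := {0}ᶜ) ?_ ?_)
    · intro c hc
      exact (key c).trans (h c hc)
    · exact (Set.finite_singleton 0).infinite_compl

/-- Modulo `g` the curve is `c • v`, so the line ideal pulls back into `(g)` and `s * f` into `(g ^
t)`. The pullback of `s` may share a root with `g`, as `s` need not be homogeneous; rescaling the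
curve by a general constant prevents this and changes the pullback of the form `f` only by a unit.
-/
theorem pow_dvd_aeval_of_mul_mem_pow [IsAlgClosed K] {σ : Type*} {v : σ → K} {φ : σ → K[X]}
    {g c : K[X]} (hg : g ≠ 0) (hc : IsCoprime c g) (hφ : ∀ i, g ∣ φ i - c * C (v i))
    {s f : MvPolynomial σ K} {d t : ℕ} (hf : f.IsHomogeneous d) (hs : s ∉ lineIdeal v)
    (hsf : s * f ∈ lineIdeal v ^ t) : g ^ t ∣ MvPolynomial.aeval φ f := by
  classical
  have : Infinite K := IsAlgClosed.instInfinite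
  set θ : MvPolynomial σ K →ₐ[K] K[X] := MvPolynomial.aeval (fun i => C (v i) * X : σ → K[X])
    with hθ
  have hq : θ s ≠ 0 := hs
  have hcr : ∀ r, g.eval r = 0 → c.eval r ≠ 0 := by
    obtain ⟨x, y, hxy⟩ := hc
    intro r hr hcr
    have := congrArg (eval r) hxy
    simp [hr, hcr] at this
  -- At a root `r` of `g` the rescaled curve sits at `(l * c(r)) • v`. The excluded `l` are `0` and
  -- those for which `s` vanishes there.
  obtain ⟨l, hl⟩ := Infinite.exists_notMem_finset
    (insert 0 (((g.roots.toFinset ×ˢ (θ s).roots.toFinset)).image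
      fun x => x.2 / c.eval x.1))
  rw [Finset.mem_insert, not_or] at hl
  obtain ⟨hl0, hl⟩ := hl
  have hlr : ∀ r, g.eval r = 0 → (θ s).eval (l * c.eval r) ≠ 0 := by
    intro r hr h
    refine hl (Finset.mem_image.2 ⟨(r, l * c.eval r), ?_, ?_⟩)
    · simp [hg, hq, hr, h]
    · simp [hcr r hr]
  set ψ : σ → K[X] := fun i => C l * φ i with hψ
  have hcongr : ∀ h : MvPolynomial σ K,
      g ∣ MvPolynomial.aeval ψ h - (θ h).comp (C l * c) := by
    intro h
    rw [← Ideal.mem_span_singleton, ← Ideal.Quotient.mk_eq_mk_iff_sub_mem]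
    have e : (Ideal.Quotient.mkₐ K (Ideal.span {g})).comp (MvPolynomial.aeval ψ) =
        ((Ideal.Quotient.mkₐ K (Ideal.span {g})).comp
          (Polynomial.aeval (C l * c))).comp θ := by
      refine MvPolynomial.algHom_ext fun i => ?_
      simp only [AlgHom.comp_apply, MvPolynomial.aeval_X, hθ]
      simp only [Ideal.Quotient.mkₐ_eq_mk]
      rw [Ideal.Quotient.mk_eq_mk_iff_sub_mem, Ideal.mem_span_singleton]
      obtain ⟨k, hk⟩ := hφ i
      refine ⟨C l * k, ?_⟩
      rw [map_mul, aeval_C, aeval_X, algebraMap_eq, hψ]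
      linear_combination C l * hk
    exact DFunLike.congr_fun e h
  have hle : lineIdeal v ≤ (Ideal.span {g}).comap (MvPolynomial.aeval ψ : _ →ₐ[K] K[X]) := by
    intro h hh
    have h0 : θ h = 0 := hh
    have := hcongr h
    rw [h0, zero_comp, sub_zero] at this
    exact Ideal.mem_span_singleton.2 this
  have h1 : g ^ t ∣ MvPolynomial.aeval ψ s * MvPolynomial.aeval ψ f := by
    have := Ideal.le_comap_pow _ t (Ideal.pow_right_mono hle t hsf)
    rwa [Ideal.span_singleton_pow, Ideal.mem_comap, Ideal.mem_span_singleton, map_mul] at this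
  have hcop : IsCoprime g (MvPolynomial.aeval ψ s) := by
    rw [Polynomial.isCoprime_iff_aeval_ne_zero_of_isAlgClosed K K]
    intro r
    by_cases hr : g.eval r = 0
    · right
      obtain ⟨k, hk⟩ := hcongr s
      have := congrArg (eval r) hk
      rw [eval_sub, eval_mul, hr, zero_mul, sub_eq_zero, eval_comp, eval_mul, eval_C] at this
      rw [coe_aeval_eq_eval, this]
      exact hlr r hr
    · left; rwa [coe_aeval_eq_eval]
  have h2 : g ^ t ∣ MvPolynomial.aeval ψ f := (hcop.pow_left).dvd_of_dvd_mul_left h1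
  have h3 : MvPolynomial.aeval ψ f = C l ^ d * MvPolynomial.aeval φ f :=
    aeval_mul_left_of_isHomogeneous _ _ hf
  rw [h3, ← C_pow] at h2
  exact ((isUnit_C.2 ((isUnit_iff_ne_zero.2 hl0).pow d)).dvd_mul_left).1 h2

end LineIdeal

/-! ### General choices: a point off `f = 0` and the polynomial `H`. -/

section GeneralChoices

open Polynomial

variable {K : Type*} [Field K]

/-- The curve is to pass at parameter `s` through the point with `U / W = u` and `V / W = v`.
Eliminating `H(s)` from these two conditions leaves the displayed equation, which is linear in `s`.
Thus `u` and `v` are chosen generally, and `s` is solved for. -/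
theorem exists_general_point [CharZero K] {ι κ : Type*} [Fintype ι] [Fintype κ]
    (a : ι → K) (k : κ → K) {f : MvPolynomial (Fin 3) K} {d : ℕ} (hf : f.IsHomogeneous d)
    (hf0 : f ≠ 0) :
    ∃ u v s : K, (∀ i, u ≠ a i) ∧ (∀ i, u ≠ k i) ∧ v ≠ 0 ∧ v ≠ 1 ∧ (∀ i, s ≠ a i) ∧
      (v - 1) * (u - s) * ∏ i, (u - k i) = v * ∏ i, (u - a i) ∧
      MvPolynomial.eval ![1 + v, 2 * u, 2 * v] f ≠ 0 := by
  classical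
  have two : (2 : K) ≠ 0 := two_ne_zero
  -- a point off the line `2 x₀ = x₂` at which `f` does not vanish
  obtain ⟨x, hx⟩ : ∃ x, MvPolynomial.eval x
      (f * (MvPolynomial.C 2 * MvPolynomial.X 0 - MvPolynomial.X 2)) ≠ 0 := by
    by_contra! h
    have h0 := MvPolynomial.funext (q := 0) (fun x => by rw [h x, map_zero])
    rcases mul_eq_zero.1 h0 with h1 | h1
    · exact hf0 h1
    · have := congrArg (MvPolynomial.eval ![1, 0, 0]) h1
      simp at this
  rw [map_mul, mul_ne_zero_iff] at hx
  obtain ⟨hfx, hw⟩ := hx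
  simp only [map_sub, map_mul, MvPolynomial.eval_C, MvPolynomial.eval_X] at hw
  -- Scaling `x` by `2 / w` brings it to the form `[1 + v : 2u : 2v]`, with `u = x₁ / w` and `v = x₂
  -- / w`.
  set w := 2 * x 0 - x 2 with hwdef
  have h1 : MvPolynomial.eval ![1 + x 2 / w, 2 * (x 1 / w), 2 * (x 2 / w)] f ≠ 0 := by
    have hscale : (![1 + x 2 / w, 2 * (x 1 / w), 2 * (x 2 / w)] : Fin 3 → K) =
        fun i => (2 / w) * x i := by
      ext i
      fin_cases i
      · simp
        field_simp
        rw [hwdef]; ring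
      · simp; ring
      · simp; ring
    rw [hscale, ← MvPolynomial.coe_aeval_eq_eval]
    change MvPolynomial.aeval _ f ≠ 0
    rw [aeval_mul_left_of_isHomogeneous _ _ hf]
    exact mul_ne_zero (pow_ne_zero _ (div_ne_zero two hw)) hfx
  obtain ⟨u, hu⟩ := Infinite.exists_notMem_finset
    ((MvPolynomial.aeval ![C (1 + x 2 / w), C 2 * X, C (2 * (x 2 / w))] f).roots.toFinset ∪
      Finset.univ.image a ∪ Finset.univ.image k)
  simp only [Finset.mem_union, not_or, Finset.mem_image, Finset.mem_univ, true_and, not_exists,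
    Multiset.mem_toFinset] at hu
  obtain ⟨⟨hu1, hu2⟩, hu3⟩ := hu
  have h2 : MvPolynomial.eval ![1 + x 2 / w, 2 * u, 2 * (x 2 / w)] f ≠ 0 := by
    have key : ∀ y : K, (MvPolynomial.aeval ![C (1 + x 2 / w), C 2 * X, C (2 * (x 2 / w))] f).eval y
        = MvPolynomial.eval ![1 + x 2 / w, 2 * y, 2 * (x 2 / w)] f := by
      intro y
      rw [eval_aeval_mvPolynomial]
      congr 2
      ext i
      fin_cases i <;> simp
    rw [mem_roots', not_and] at hu1
    rw [← key]
    refine hu1 fun h => h1 ?_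
    rw [← key, h, eval_zero]
  have hP : ∏ i, (u - a i) ≠ 0 :=
    Finset.prod_ne_zero_iff.2 fun i _ => sub_ne_zero.2 fun h => hu2 i h.symm
  have hR : ∏ i, (u - k i) ≠ 0 :=
    Finset.prod_ne_zero_iff.2 fun i _ => sub_ne_zero.2 fun h => hu3 i h.symm
  set P := ∏ i, (u - a i)
  set R := ∏ i, (u - k i)
  -- The last family of excluded values consists of the `v` for which the solution `s` would be a
  -- node `a i`.
  obtain ⟨v, hv⟩ := Infinite.exists_notMem_finset
    ((MvPolynomial.aeval ![1 + X, C (2 * u), C 2 * X] f).roots.toFinset ∪ {0, 1} ∪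
      Finset.univ.image fun i => (u - a i) * R / ((u - a i) * R - P))
  simp only [Finset.mem_union, not_or, Finset.mem_image, Finset.mem_univ, true_and, not_exists,
    Multiset.mem_toFinset, Finset.mem_insert, Finset.mem_singleton] at hv
  obtain ⟨⟨hv1, hv2, hv3⟩, hv4⟩ := hv
  have hv3' : v - 1 ≠ 0 := sub_ne_zero.2 hv3
  refine ⟨u, v, u - v * P / ((v - 1) * R), fun i h => hu2 i h.symm, fun i h => hu3 i h.symm,
    hv2, hv3, fun i hi => ?_, by field_simp; ring, ?_⟩
  · have h3 : v * P = (v - 1) * R * (u - a i) := by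
      rw [← hi]; field_simp; ring
    have h4 : (u - a i) * R = v * ((u - a i) * R - P) := by linear_combination h3
    have h5 : (u - a i) * R - P ≠ 0 := by
      intro h
      rw [h, mul_zero, mul_eq_zero] at h4
      exact h4.elim (sub_ne_zero.2 fun h => hu2 i h.symm) hR
    exact hv4 i ((div_eq_iff h5).2 h4)
  · have key : ∀ y : K, (MvPolynomial.aeval ![1 + X, C (2 * u), C 2 * X] f).eval y
        = MvPolynomial.eval ![1 + y, 2 * u, 2 * y] f := by
      intro y
      rw [eval_aeval_mvPolynomial]
      congr 2
      ext i
      fin_cases i <;> simp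
    rw [mem_roots', not_and] at hv1
    rw [← key]
    refine hv1 fun h => h2 ?_
    rw [← key, h, eval_zero]

/-- The value at `s` and the two top coefficients are built in through `H = η + (X - s) Q`. The free
coefficient `r` of `(X - τ)^(2n)` in `Q` then has only finitely many forbidden values, because `τ`
and `s` are not nodes. -/
theorem exists_interpolant [Infinite K] {ι : Type*} [Fintype ι] (n : ℕ) (a : ι → K) {τ s : K}
    (hτ : ∀ i, a i ≠ τ) (hs : ∀ i, s ≠ a i) (η c : K) (B : Finset K) :
    ∃ H : K[X], H.natDegree ≤ 2 * n + 3 ∧ H.coeff (2 * n + 3) = -1 ∧ H.coeff (2 * n + 2) = c ∧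
      H.coeff (2 * n + 1) ∉ B ∧ H.eval s = η ∧ ∀ i, H.eval (a i) ≠ 0 := by
  classical
  set Q : K → K[X] := fun r =>
    -X ^ (2 * n + 2) + C (c - s) * X ^ (2 * n + 1) + C r * (X - C τ) ^ (2 * n) with hQ
  have hnd : ((X - C τ) ^ (2 * n)).natDegree = 2 * n := by rw [natDegree_pow, natDegree_X_sub_C, mul_one]
  have hdeg : ∀ r, (Q r).natDegree ≤ 2 * n + 2 := by
    intro r
    have : (C r * (X - C τ) ^ (2 * n)).natDegree ≤ 2 * n + 2 :=
      (natDegree_C_mul_le _ _).trans (by omega)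
    refine (natDegree_add_le_of_degree_le (natDegree_add_le_of_degree_le ?_ ?_) this)
    · rw [natDegree_neg, natDegree_X_pow]
    · exact (natDegree_C_mul_X_pow_le _ _).trans (by omega)
  have hc0 : ((X - C τ) ^ (2 * n)).coeff (2 * n) = 1 := by
    have := ((monic_X_sub_C τ).pow (2 * n)).coeff_natDegree
    rwa [hnd] at this
  have hc1 : ∀ j, 2 * n < j → ((X - C τ) ^ (2 * n)).coeff j = 0 := fun j hj =>
    coeff_eq_zero_of_natDegree_lt (by omega)
  have q3 : ∀ r, (Q r).coeff (2 * n + 3) = 0 := fun r =>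
    coeff_eq_zero_of_natDegree_lt (by have := hdeg r; omega)
  have q2 : ∀ r, (Q r).coeff (2 * n + 2) = -1 := by
    intro r
    simp only [hQ, coeff_add, coeff_neg, coeff_X_pow, coeff_C_mul, hc1 (2 * n + 2) (by omega)]
    simp
  have q1 : ∀ r, (Q r).coeff (2 * n + 1) = c - s := by
    intro r
    simp only [hQ, coeff_add, coeff_neg, coeff_X_pow, coeff_C_mul, hc1 (2 * n + 1) (by omega)]
    simp
  have q0 : ∀ r, (Q r).coeff (2 * n) = r := by
    intro r
    simp only [hQ, coeff_add, coeff_neg, coeff_X_pow, coeff_C_mul, hc0]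
    simp
  set H : K → K[X] := fun r => C η + (X - C s) * Q r with hH
  have hHc : ∀ r j, (H r).coeff (j + 1) = (Q r).coeff j - (Q r).coeff (j + 1) * s := by
    intro r j
    rw [hH]
    simp only [coeff_add, coeff_C_succ, zero_add, coeff_X_sub_C_mul]
    ring
  obtain ⟨r, hr⟩ := Infinite.exists_notMem_finset
    (B.image (fun x => x + (c - s) * s) ∪ Finset.univ.image fun i =>
      (-η / (a i - s) + a i ^ (2 * n + 2) - (c - s) * a i ^ (2 * n + 1)) / (a i - τ) ^ (2 * n))
  simp only [Finset.mem_union, not_or, Finset.mem_image, Finset.mem_univ, true_and,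
    not_exists] at hr
  obtain ⟨hr1, hr2⟩ := hr
  refine ⟨H r, ?_, ?_, ?_, ?_, ?_, ?_⟩
  · refine natDegree_add_le_of_degree_le (by rw [natDegree_C]; omega) ?_
    refine natDegree_mul_le.trans ?_
    rw [natDegree_X_sub_C]
    have := hdeg r
    omega
  · rw [hHc, q2, q3]; ring
  · rw [hHc, q1, q2]; ring
  · rw [hHc, q0, q1]
    intro h
    exact hr1 _ ⟨h, by ring⟩
  · simp [hH]
  · intro i hi
    have h1 : a i - s ≠ 0 := sub_ne_zero.2 fun h => hs i h.symm
    have h2 : (a i - τ) ^ (2 * n) ≠ 0 := pow_ne_zero _ (sub_ne_zero.2 (hτ i))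
    refine hr2 i ?_
    simp only [hH, hQ, eval_add, eval_mul, eval_sub, eval_neg, eval_pow, eval_C, eval_X] at hi
    rw [div_eq_iff h2]
    field_simp
    linear_combination -hi

end GeneralChoices

/-! ### The rational curve: fibers of its projection, common roots and degrees. -/

section RationalCurve

open Polynomial

variable {K : Type*} [Field K] {n : ℕ}

/-- The polynomial `∏ (X - a i)`. -/
noncomputable def nodePoly (a : Fin (n + 1) → K) : K[X] := ∏ i, (X - C (a i))

/-- The polynomial `∏_{j ≠ i} (X - a j)`. -/
noncomputable def nodeCofactor (a : Fin (n + 1) → K) (i : Fin (n + 1)) : K[X] :=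
  ∏ j ∈ Finset.univ.erase i, (X - C (a j))

/-- The numerator of the projection `X + E ^ 2 / H` of the curve, where `E` is the node
polynomial. -/
noncomputable def curveNumer (a : Fin (n + 1) → K) (H : K[X]) : K[X] := X * H + nodePoly a ^ 2

/-- The numerator of the difference of the projection and the constant `x`. -/
noncomputable def fiberPoly (a : Fin (n + 1) → K) (H : K[X]) (x : K) : K[X] :=
  curveNumer a H - C x * H

/-- The fiber polynomial at the node `a i`, divided by `X - a i`. -/
noncomputable def midFactor (a : Fin (n + 1) → K) (H : K[X]) (i : Fin (n + 1)) : K[X] :=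
  H + nodePoly a * nodeCofactor a i

/-- The vertical coordinate of the curve. -/
noncomputable def curveVert (a : Fin (n + 1) → K) (k : Fin n → K) (H : K[X]) : K[X] :=
  nodePoly a * ∏ i, fiberPoly a H (k i)

/-- The denominator of the vertical coordinate of the curve. -/
noncomputable def curveDenom (a : Fin (n + 1) → K) (k : Fin n → K) (H : K[X]) : K[X] :=
  curveVert a k H - ∏ i, midFactor a H i

variable {a : Fin (n + 1) → K} {k : Fin n → K} {H : K[X]}

theorem mul_nodeCofactor (i : Fin (n + 1)) : (X - C (a i)) * nodeCofactor a i = nodePoly a :=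
  Finset.mul_prod_erase _ (fun j => X - C (a j)) (Finset.mem_univ i)

theorem nodePoly_mul_prod_nodeCofactor :
    nodePoly a * ∏ i, nodeCofactor a i = nodePoly a ^ (n + 1) := by
  conv_lhs => rw [nodePoly, ← Finset.prod_mul_distrib]
  simp [mul_nodeCofactor]

theorem mul_midFactor (i : Fin (n + 1)) :
    (X - C (a i)) * midFactor a H i = fiberPoly a H (a i) := by
  rw [midFactor, fiberPoly, curveNumer, mul_add, mul_left_comm, mul_nodeCofactor]
  ring

/-- Modulo `H` each `F_(k j)` is `E²` and each `M_i` is `E` times a cofactor, while the cofactors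
multiply to `E^n`. Both terms of the denominator reduce to `E^(2n+1)`. -/
theorem dvd_curveDenom : H ∣ curveDenom a k H := by
  rw [← Ideal.mem_span_singleton, ← Ideal.Quotient.eq_zero_iff_mem]
  have hH : Ideal.Quotient.mk (Ideal.span {H}) H = 0 :=
    Ideal.Quotient.eq_zero_iff_mem.2 (Ideal.mem_span_singleton_self H)
  have h1 : Ideal.Quotient.mk (Ideal.span {H}) (curveVert a k H) =
      Ideal.Quotient.mk (Ideal.span {H}) (nodePoly a) ^ (2 * n + 1) := by
    simp only [curveVert, fiberPoly, curveNumer, map_mul, map_prod, map_sub, map_add, map_pow, hH]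
    simp only [mul_zero, zero_add, sub_zero, Finset.prod_const, Finset.card_univ, Fintype.card_fin]
    ring
  have h2 : Ideal.Quotient.mk (Ideal.span {H}) (∏ i, midFactor a H i) =
      Ideal.Quotient.mk (Ideal.span {H}) (nodePoly a) ^ (2 * n + 1) := by
    have h3 : nodePoly a ^ (n + 1) * ∏ i, nodeCofactor a i = nodePoly a ^ (2 * n + 1) := by
      rw [pow_succ, mul_assoc, nodePoly_mul_prod_nodeCofactor, ← pow_add]
      congr 1; ring
    rw [← map_pow, ← h3]
    simp only [midFactor, map_prod, map_add, map_mul, hH, zero_add, Finset.prod_mul_distrib,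
      Finset.prod_const, Finset.card_univ, Fintype.card_fin, map_pow]
  rw [curveDenom, map_sub, h1, h2, sub_self]

theorem natDegree_nodePoly : (nodePoly a).natDegree = n + 1 := by
  rw [nodePoly, natDegree_prod_of_monic _ _ fun i _ => monic_X_sub_C _]
  simp

theorem monic_nodePoly : (nodePoly a).Monic := monic_prod_of_monic _ _ fun _ _ => monic_X_sub_C _

theorem eval_nodePoly_eq_zero_iff {r : K} : (nodePoly a).eval r = 0 ↔ ∃ i, r = a i := by
  simp [nodePoly, eval_prod, Finset.prod_eq_zero_iff, sub_eq_zero]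

theorem eval_fiberPoly (x r : K) :
    (fiberPoly a H x).eval r = (r - x) * H.eval r + (nodePoly a).eval r ^ 2 := by
  simp [fiberPoly, curveNumer]; ring

theorem eval_midFactor (i : Fin (n + 1)) (r : K) :
    (r - a i) * (midFactor a H i).eval r = (fiberPoly a H (a i)).eval r := by
  rw [← mul_midFactor]; simp

/-! ### Common roots -/

theorem eval_nodePoly_ne_zero_of_midFactor (hH : ∀ i, H.eval (a i) ≠ 0) {r : K}
    {i : Fin (n + 1)} (h : (midFactor a H i).eval r = 0) : (nodePoly a).eval r ≠ 0 := by
  intro hE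
  obtain ⟨j, rfl⟩ := eval_nodePoly_eq_zero_iff.1 hE
  rw [midFactor, eval_add, eval_mul, hE, zero_mul, add_zero] at h
  exact hH j h

theorem eval_nodePoly_ne_zero_of_fiberPoly (hH : ∀ i, H.eval (a i) ≠ 0) {r x : K}
    (hx : ∀ i, a i ≠ x) (h : (fiberPoly a H x).eval r = 0) : (nodePoly a).eval r ≠ 0 := by
  intro hE
  obtain ⟨j, rfl⟩ := eval_nodePoly_eq_zero_iff.1 hE
  rw [eval_fiberPoly, hE, zero_pow two_ne_zero, add_zero, mul_eq_zero, sub_eq_zero] at h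
  exact h.elim (hx j) (hH j)

/-- A common root of two different fibers is a common root of `H` and `E`. -/
theorem eq_of_eval_fiberPoly_eq_zero {r x y : K} (hE : (nodePoly a).eval r ≠ 0)
    (hx : (fiberPoly a H x).eval r = 0) (hy : (fiberPoly a H y).eval r = 0) : x = y := by
  by_contra hxy
  rw [eval_fiberPoly] at hx hy
  have h : (x - y) * H.eval r = 0 := by linear_combination hy - hx
  have h0 := (mul_eq_zero.1 h).resolve_left (sub_ne_zero.2 hxy)
  rw [h0, mul_zero, zero_add] at hx
  exact hE (pow_eq_zero_iff two_ne_zero |>.1 hx)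

theorem eval_fiberPoly_of_midFactor {r : K} {i : Fin (n + 1)}
    (h : (midFactor a H i).eval r = 0) : (fiberPoly a H (a i)).eval r = 0 := by
  rw [← eval_midFactor, h, mul_zero]

/-- A common root would either be a node, where `M_i` takes the value of `H`, or lie in the fibers
over both some `a i` and some `k j`. -/
theorem eval_prod_midFactor_ne_zero (hH : ∀ i, H.eval (a i) ≠ 0) (hak : ∀ i j, a i ≠ k j) {r : K}
    (hV : (curveVert a k H).eval r = 0) : (∏ i, midFactor a H i).eval r ≠ 0 := by
  intro hM
  rw [eval_prod, Finset.prod_eq_zero_iff] at hM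
  obtain ⟨i, -, hM⟩ := hM
  have hE := eval_nodePoly_ne_zero_of_midFactor hH hM
  rw [curveVert, eval_mul, mul_eq_zero, or_iff_right hE, eval_prod, Finset.prod_eq_zero_iff] at hV
  obtain ⟨j, -, hV⟩ := hV
  exact hak i j (eq_of_eval_fiberPoly_eq_zero hE (eval_fiberPoly_of_midFactor hM) hV)

/-! ### Degrees -/

/-- The leading coefficient `-1` of `H` makes `X * H` cancel the top term of `E²`. -/
theorem natDegree_fiberPoly_le (hH : H.natDegree ≤ 2 * n + 1) (hc : H.coeff (2 * n + 1) = -1)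
    (x : K) : (fiberPoly a H x).natDegree ≤ 2 * n + 1 := by
  have hE : (nodePoly a ^ 2).natDegree = 2 * n + 2 := by
    rw [natDegree_pow, natDegree_nodePoly]; ring
  have h1 : (curveNumer a H).natDegree ≤ 2 * n + 2 := by
    refine natDegree_add_le_of_degree_le (natDegree_mul_le.trans ?_) hE.le
    rw [natDegree_X]; omega
  have h2 : (curveNumer a H).coeff (2 * n + 2) = 0 := by
    have := (monic_nodePoly (a := a)).pow 2 |>.coeff_natDegree
    rw [hE] at this
    rw [curveNumer, coeff_add, coeff_X_mul, hc, this]; ring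
  exact natDegree_sub_le_of_le (natDegree_le_pred h1 h2) ((natDegree_C_mul_le _ _).trans hH)
    |>.trans (by simp)

theorem coeff_fiberPoly (x : K) (j : ℕ) : (fiberPoly a H x).coeff (j + 1) =
    H.coeff j + (nodePoly a ^ 2).coeff (j + 1) - x * H.coeff (j + 1) := by
  rw [fiberPoly, curveNumer, coeff_sub, coeff_add, coeff_X_mul, coeff_C_mul]

end RationalCurve

/-! ### Exact degrees of the curve, and its contact with the points. -/

section RationalCurve

open Polynomial

variable {K : Type*} [Field K] {n : ℕ} {a : Fin (n + 1) → K} {k : Fin n → K} {H : K[X]}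

/-- The prescribed second coefficient of `H` makes the projection take the value `x₀` at infinity,
so only the fiber over `x₀` loses a root. -/
theorem coeff_top_fiberPoly (hc : H.coeff (2 * n + 1) = -1) {x₀ : K}
    (hc' : H.coeff (2 * n) = -(nodePoly a ^ 2).coeff (2 * n + 1) - x₀) (x : K) :
    (fiberPoly a H x).coeff (2 * n + 1) = x - x₀ := by
  rw [coeff_fiberPoly, hc, hc']; ring

theorem natDegree_fiberPoly (hH : H.natDegree ≤ 2 * n + 1) (hc : H.coeff (2 * n + 1) = -1) {x₀ : K}
    (hc' : H.coeff (2 * n) = -(nodePoly a ^ 2).coeff (2 * n + 1) - x₀) {x : K} (hx : x ≠ x₀) :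
    (fiberPoly a H x).natDegree = 2 * n + 1 := by
  refine natDegree_eq_of_le_of_coeff_ne_zero (natDegree_fiberPoly_le hH hc x) ?_
  rw [coeff_top_fiberPoly hc hc']
  exact sub_ne_zero.2 hx

theorem natDegree_fiberPoly_self_le (hH : H.natDegree ≤ 2 * n + 1) (hc : H.coeff (2 * n + 1) = -1)
    {x₀ : K} (hc' : H.coeff (2 * n) = -(nodePoly a ^ 2).coeff (2 * n + 1) - x₀) :
    (fiberPoly a H x₀).natDegree ≤ 2 * n := by
  refine natDegree_le_pred (natDegree_fiberPoly_le hH hc x₀) ?_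
  rw [coeff_top_fiberPoly hc hc', sub_self]

theorem natDegree_midFactor (hH : H.natDegree ≤ 2 * n + 1) (hc : H.coeff (2 * n + 1) = -1)
    {x₀ : K} (hc' : H.coeff (2 * n) = -(nodePoly a ^ 2).coeff (2 * n + 1) - x₀)
    {i : Fin (n + 1)} (hx : a i ≠ x₀) :
    (midFactor a H i).natDegree = 2 * n ∧ (midFactor a H i).coeff (2 * n) = a i - x₀ := by
  have h1 := natDegree_fiberPoly hH hc hc' hx
  have h2 := coeff_top_fiberPoly hc hc' (a i)
  have h0 : midFactor a H i ≠ 0 := by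
    intro h
    rw [← mul_midFactor, h, mul_zero, natDegree_zero] at h1
    omega
  rw [← mul_midFactor, natDegree_mul (X_sub_C_ne_zero _) h0, natDegree_X_sub_C] at h1
  have h3 : (midFactor a H i).natDegree = 2 * n := by omega
  refine ⟨h3, ?_⟩
  rw [← mul_midFactor, coeff_X_sub_C_mul,
    coeff_eq_zero_of_natDegree_lt (show (midFactor a H i).natDegree < 2 * n + 1 by omega)] at h2
  rw [← h2]; ring

/-- If all odd fibers had full degree, the numerator of the vertical coordinate would have degree `T
+ 1`. Sending infinity to `k j₀` removes one root and brings it to `T`. Condition `h₂` keeps the top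
coefficients of the two terms of the denominator from cancelling. -/
theorem natDegree_curveDenom {j₀ : Fin n} (hk : Function.Injective k) (hak : ∀ i j, a i ≠ k j)
    (hH : H.natDegree ≤ 2 * n + 1) (hc : H.coeff (2 * n + 1) = -1)
    (hc' : H.coeff (2 * n) = -(nodePoly a ^ 2).coeff (2 * n + 1) - k j₀)
    (h₁ : (fiberPoly a H (k j₀)).coeff (2 * n) ≠ 0)
    (h₂ : (fiberPoly a H (k j₀)).coeff (2 * n) * ∏ j ∈ Finset.univ.erase j₀, (k j - k j₀) ≠
      ∏ i, (a i - k j₀)) :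
    (fiberPoly a H (k j₀)).natDegree = 2 * n ∧
    ∑ j, (fiberPoly a H (k j)).natDegree + (2 * n + 1) = n * (2 * n + 1) + 2 * n ∧
    (curveVert a k H).natDegree ≤ 2 * n * (n + 1) ∧
    (curveDenom a k H).natDegree = 2 * n * (n + 1) := by
  have d₀ : (fiberPoly a H (k j₀)).natDegree = 2 * n :=
    natDegree_eq_of_le_of_coeff_ne_zero (natDegree_fiberPoly_self_le hH hc hc') h₁
  have d : ∀ j ∈ Finset.univ.erase j₀, (fiberPoly a H (k j)).natDegree = 2 * n + 1 := fun j hj =>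
    natDegree_fiberPoly hH hc hc' (hk.ne (Finset.ne_of_mem_erase hj))
  have lc : ∏ j, (fiberPoly a H (k j)).leadingCoeff =
      (fiberPoly a H (k j₀)).coeff (2 * n) * ∏ j ∈ Finset.univ.erase j₀, (k j - k j₀) := by
    rw [← Finset.mul_prod_erase _ _ (Finset.mem_univ j₀), leadingCoeff, d₀]
    congr 1
    refine Finset.prod_congr rfl fun j hj => ?_
    rw [leadingCoeff, d j hj, coeff_top_fiberPoly hc hc']
  have hcard : 0 < n := j₀.pos
  have hsum : ∑ j, (fiberPoly a H (k j)).natDegree + (2 * n + 1) = n * (2 * n + 1) + 2 * n := by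
    rw [← Finset.add_sum_erase _ _ (Finset.mem_univ j₀), d₀, Finset.sum_congr rfl d,
      Finset.sum_const, Finset.card_erase_of_mem (Finset.mem_univ _), Finset.card_univ,
      Fintype.card_fin, smul_eq_mul]
    obtain ⟨m, rfl⟩ : ∃ m, n = m + 1 := ⟨n - 1, by omega⟩
    rw [Nat.add_sub_cancel]
    ring
  have hne : ∀ j ∈ Finset.univ, fiberPoly a H (k j) ≠ 0 := by
    intro j _ h
    by_cases hj : j = j₀
    · subst hj
      rw [h, coeff_zero] at h₁
      exact h₁ rfl
    · have := d j (Finset.mem_erase.2 ⟨hj, Finset.mem_univ j⟩)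
      rw [h, natDegree_zero] at this
      omega
  have hprod : (∏ j, fiberPoly a H (k j)).natDegree = ∑ j, (fiberPoly a H (k j)).natDegree :=
    natDegree_prod _ _ hne
  have hV : (curveVert a k H).natDegree = 2 * n * (n + 1) := by
    rw [curveVert, natDegree_mul monic_nodePoly.ne_zero (Finset.prod_ne_zero_iff.2 hne), hprod,
      natDegree_nodePoly]
    nlinarith
  have hVl : (curveVert a k H).coeff (2 * n * (n + 1)) =
      (fiberPoly a H (k j₀)).coeff (2 * n) * ∏ j ∈ Finset.univ.erase j₀, (k j - k j₀) := by
    rw [← hV, coeff_natDegree, curveVert, leadingCoeff_mul, leadingCoeff_prod, lc,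
      monic_nodePoly.leadingCoeff, one_mul]
  have hM : ∀ i ∈ Finset.univ, (midFactor a H i).natDegree ≤ 2 * n := fun i _ =>
    (natDegree_midFactor hH hc hc' (hak i j₀)).1.le
  have hMc : (∏ i, midFactor a H i).coeff (2 * n * (n + 1)) = ∏ i, (a i - k j₀) := by
    have := coeff_prod_of_natDegree_le _ _ _ hM
    rw [Finset.card_univ, Fintype.card_fin, mul_comm] at this
    rw [this]
    exact Finset.prod_congr rfl fun i _ => (natDegree_midFactor hH hc hc' (hak i j₀)).2
  have hMd : (∏ i, midFactor a H i).natDegree ≤ 2 * n * (n + 1) := by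
    refine (natDegree_prod_le _ _).trans ((Finset.sum_le_sum hM).trans ?_)
    simp [mul_comm]
  refine ⟨d₀, hsum, hV.le, natDegree_eq_of_le_of_coeff_ne_zero ?_ ?_⟩
  · exact (natDegree_sub_le_of_le hV.le hMd).trans (max_self _).le
  · rw [curveDenom, coeff_sub, hVl, hMc]
    exact sub_ne_zero.2 h₂

/-- The index type of the points of the configuration: the top point, the `n + 1` points of the
middle row, the `n + 1` even points and the `n` odd points of the bottom row. -/
abbrev PointIndex (n : ℕ) : Type := Unit ⊕ Fin (n + 1) ⊕ Fin (n + 1) ⊕ Fin n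

/-- Homogeneous coordinates of the points of the configuration. -/
def pointVec (a : Fin (n + 1) → K) (k : Fin n → K) : PointIndex n → Fin 3 → K :=
  Sum.elim (fun _ => ![1, 0, 2]) <| Sum.elim (fun i => ![1, a i, 1]) <|
    Sum.elim (fun i => ![1, 2 * a i, 0]) fun j => ![1, 2 * k j, 0]

/-- The local equations of the points of the configuration, pulled back to the curve. -/
noncomputable def curveFactor (a : Fin (n + 1) → K) (k : Fin n → K) (H G : K[X]) :
    PointIndex n → K[X] :=
  Sum.elim (fun _ => G) <| Sum.elim (fun i => midFactor a H i) <|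
    Sum.elim (fun i => X - C (a i)) fun j => fiberPoly a H (k j)

/-- The factor of proportionality between the curve and the points of the configuration. -/
noncomputable def curveScale (a : Fin (n + 1) → K) (k : Fin n → K) (H : K[X]) :
    PointIndex n → K[X] :=
  Sum.elim (fun _ => curveVert a k H) <| Sum.elim (fun _ => C 2 * curveVert a k H) <|
    Sum.elim (fun _ => curveDenom a k H) fun _ => curveDenom a k H

/-- The homogeneous coordinates of the curve. -/
noncomputable def curveMap (a : Fin (n + 1) → K) (k : Fin n → K) (H G : K[X]) : Fin 3 → K[X] :=
  ![curveDenom a k H + curveVert a k H, C 2 * (curveNumer a H * G), C 2 * curveVert a k H]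

theorem isCoprime_of_eval_ne_zero [IsAlgClosed K] {p q : K[X]}
    (h : ∀ r, p.eval r = 0 → q.eval r ≠ 0) : IsCoprime p q := by
  rw [Polynomial.isCoprime_iff_aeval_ne_zero_of_isAlgClosed K K]
  intro r
  rw [coe_aeval_eq_eval]
  by_cases hr : p.eval r = 0
  · exact Or.inr (h r hr)
  · exact Or.inl hr

theorem eval_prod_midFactor_eq_zero {i : Fin (n + 1)} {r : K}
    (h : (midFactor a H i).eval r = 0) : (∏ i, midFactor a H i).eval r = 0 := by
  rw [eval_prod]
  exact Finset.prod_eq_zero (Finset.mem_univ i) h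

theorem eval_curveVert_eq_zero_of_node {i : Fin (n + 1)} {r : K}
    (h : (X - C (a i)).eval r = 0) : (curveVert a k H).eval r = 0 := by
  rw [curveVert, eval_mul, eval_nodePoly_eq_zero_iff.2 ⟨i, by simpa [sub_eq_zero] using h⟩,
    zero_mul]

theorem eval_curveVert_eq_zero_of_fiberPoly {j : Fin n} {r : K}
    (h : (fiberPoly a H (k j)).eval r = 0) : (curveVert a k H).eval r = 0 := by
  rw [curveVert, eval_mul, eval_prod, Finset.prod_eq_zero (Finset.mem_univ j) h, mul_zero]

theorem eval_curveDenom_ne_zero (hHa : ∀ i, H.eval (a i) ≠ 0) (hak : ∀ i j, a i ≠ k j) {r : K}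
    (h : (curveVert a k H).eval r = 0) : (curveDenom a k H).eval r ≠ 0 := by
  rw [curveDenom, eval_sub, h, zero_sub]
  exact neg_ne_zero.2 (eval_prod_midFactor_ne_zero hHa hak h)

section Factors

variable {G : K[X]}

theorem eval_curveVert_eq_of_cofactor (hG : curveDenom a k H = H * G) {r : K}
    (h : G.eval r = 0) : (curveVert a k H).eval r = (∏ i, midFactor a H i).eval r := by
  have := congrArg (eval r) hG
  rwa [curveDenom, eval_sub, eval_mul, h, mul_zero, sub_eq_zero] at this

theorem eval_curveVert_ne_zero_of_cofactor (hHa : ∀ i, H.eval (a i) ≠ 0)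
    (hak : ∀ i j, a i ≠ k j) (hG : curveDenom a k H = H * G) {r : K} (h : G.eval r = 0) :
    (curveVert a k H).eval r ≠ 0 := fun hv =>
  eval_prod_midFactor_ne_zero hHa hak hv (by rw [← eval_curveVert_eq_of_cofactor hG h, hv])

theorem pairwise_isCoprime_curveFactor [IsAlgClosed K] (ha : Function.Injective a)
    (hk : Function.Injective k) (hHa : ∀ i, H.eval (a i) ≠ 0) (hak : ∀ i j, a i ≠ k j)
    (hG : curveDenom a k H = H * G) : Pairwise (Function.onFun IsCoprime (curveFactor a k H G)) := by
  have GV : ∀ r, G.eval r = 0 → (curveVert a k H).eval r ≠ 0 := fun r =>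
    eval_curveVert_ne_zero_of_cofactor hHa hak hG
  have cop₁ : ∀ i, IsCoprime G (midFactor a H i) := fun i =>
    isCoprime_of_eval_ne_zero fun r h h' => GV r h (by
      rw [eval_curveVert_eq_of_cofactor hG h, eval_prod_midFactor_eq_zero h'])
  have cop₂ : ∀ i, IsCoprime G (X - C (a i)) := fun i =>
    isCoprime_of_eval_ne_zero fun r h h' => GV r h (eval_curveVert_eq_zero_of_node h')
  have cop₃ : ∀ j, IsCoprime G (fiberPoly a H (k j)) := fun j =>
    isCoprime_of_eval_ne_zero fun r h h' => GV r h (eval_curveVert_eq_zero_of_fiberPoly h')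
  have cop₄ : ∀ i j, IsCoprime (midFactor a H i) (X - C (a j)) := fun i j =>
    isCoprime_of_eval_ne_zero fun r h h' =>
      eval_prod_midFactor_ne_zero (k := k) hHa hak (eval_curveVert_eq_zero_of_node h')
        (eval_prod_midFactor_eq_zero h)
  have cop₅ : ∀ i j, IsCoprime (midFactor a H i) (fiberPoly a H (k j)) := fun i j =>
    isCoprime_of_eval_ne_zero fun r h h' =>
      eval_prod_midFactor_ne_zero hHa hak (eval_curveVert_eq_zero_of_fiberPoly h')
        (eval_prod_midFactor_eq_zero h)
  have cop₆ : ∀ i j, IsCoprime (X - C (a i)) (fiberPoly a H (k j)) := fun i j =>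
    isCoprime_of_eval_ne_zero fun r h h' =>
      eval_nodePoly_ne_zero_of_fiberPoly hHa (fun i => hak i j) h'
        (eval_nodePoly_eq_zero_iff.2 ⟨i, by simpa [sub_eq_zero] using h⟩)
  rintro (_ | i | i | i) (_ | j | j | j) hij
  · exact absurd rfl hij
  · exact cop₁ j
  · exact cop₂ j
  · exact cop₃ j
  · exact (cop₁ i).symm
  · refine isCoprime_of_eval_ne_zero fun r h h' => hij ?_
    rw [ha (eq_of_eval_fiberPoly_eq_zero (eval_nodePoly_ne_zero_of_midFactor hHa h)
      (eval_fiberPoly_of_midFactor h) (eval_fiberPoly_of_midFactor h'))]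
  · exact cop₄ i j
  · exact cop₅ i j
  · exact (cop₂ i).symm
  · exact (cop₄ j i).symm
  · refine isCoprime_X_sub_C_of_isUnit_sub (IsUnit.mk0 _ (sub_ne_zero.2 (ha.ne ?_)))
    rintro rfl
    exact hij rfl
  · exact cop₆ i j
  · exact (cop₃ i).symm
  · exact (cop₅ j i).symm
  · exact (cop₆ j i).symm
  · refine isCoprime_of_eval_ne_zero fun r h h' => hij ?_
    rw [hk (eq_of_eval_fiberPoly_eq_zero
      (eval_nodePoly_ne_zero_of_fiberPoly hHa (fun l => hak l i) h) h h')]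

theorem curveFactor_ne_zero (hHa : ∀ i, H.eval (a i) ≠ 0) (hak : ∀ i j, a i ≠ k j)
    (hG : G ≠ 0) (p : PointIndex n) : curveFactor a k H G p ≠ 0 := by
  have h0 : (nodePoly a).eval (a 0) = 0 := eval_nodePoly_eq_zero_iff.2 ⟨0, rfl⟩
  rcases p with _ | i | i | j
  · exact hG
  · intro h
    refine eval_nodePoly_ne_zero_of_midFactor hHa (i := i) ?_ h0
    rw [show midFactor a H i = 0 from h, eval_zero]
  · exact X_sub_C_ne_zero _
  · intro h
    refine eval_nodePoly_ne_zero_of_fiberPoly hHa (fun i => hak i j) ?_ h0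
    rw [show fiberPoly a H (k j) = 0 from h, eval_zero]

theorem isCoprime_curveScale_curveFactor [IsAlgClosed K] [CharZero K]
    (hHa : ∀ i, H.eval (a i) ≠ 0) (hak : ∀ i j, a i ≠ k j) (hG : curveDenom a k H = H * G)
    (p : PointIndex n) : IsCoprime (curveScale a k H p) (curveFactor a k H G p) := by
  rcases p with _ | i | i | j
  · exact (isCoprime_of_eval_ne_zero fun r =>
      eval_curveVert_ne_zero_of_cofactor hHa hak hG).symm
  · change IsCoprime (C 2 * curveVert a k H) (midFactor a H i)
    refine isCoprime_of_eval_ne_zero fun r h h' => ?_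
    rw [eval_mul, eval_C] at h
    exact eval_prod_midFactor_ne_zero hHa hak ((mul_eq_zero.1 h).resolve_left two_ne_zero)
      (eval_prod_midFactor_eq_zero h')
  · exact isCoprime_of_eval_ne_zero fun r h h' =>
      eval_curveDenom_ne_zero hHa hak (eval_curveVert_eq_zero_of_node h') h
  · exact isCoprime_of_eval_ne_zero fun r h h' =>
      eval_curveDenom_ne_zero hHa hak (eval_curveVert_eq_zero_of_fiberPoly h') h

theorem numer_sub_denom (hG : curveDenom a k H = H * G) (x : K) :
    curveNumer a H * G - C x * curveDenom a k H = fiberPoly a H x * G := by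
  rw [hG, fiberPoly]; ring

/-- Since `U - x W = F_x G`, the first coordinate is correct on the roots of `F_x`. The remaining
coordinates use `V ≡ 0` on the bottom row, `W ≡ V` on the middle row and `U ≡ W ≡ 0` at the top. -/
theorem curveFactor_dvd (hG : curveDenom a k H = H * G) (p : PointIndex n) (l : Fin 3) :
    curveFactor a k H G p ∣ curveMap a k H G l - curveScale a k H p * C (pointVec a k p l) := by
  have hUa : ∀ i, curveNumer a H * G - C (a i) * curveDenom a k H =
      (X - C (a i)) * midFactor a H i * G := fun i => by
    rw [numer_sub_denom hG, mul_midFactor]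
  have hUx := fun x => numer_sub_denom hG x
  have hXV : ∀ i, X - C (a i) ∣ curveVert a k H := fun i =>
    Dvd.dvd.mul_right ⟨_, (mul_nodeCofactor i).symm⟩ _
  have hMV : ∀ i, midFactor a H i ∣ curveDenom a k H - curveVert a k H := fun i => by
    rw [curveDenom, sub_sub_cancel_left, dvd_neg]
    exact Finset.dvd_prod_of_mem _ (Finset.mem_univ i)
  have hOV : ∀ j, fiberPoly a H (k j) ∣ curveVert a k H := fun j =>
    Dvd.dvd.mul_left (Finset.dvd_prod_of_mem (fun j => fiberPoly a H (k j)) (Finset.mem_univ j)) _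
  have hGW : G ∣ curveDenom a k H := ⟨H, by rw [hG, mul_comm]⟩
  have hGU : G ∣ curveNumer a H * G := Dvd.intro_left _ rfl
  have c2 : (C 2 : K[X]) = 2 := rfl
  rcases p with _ | i | i | j
  · change G ∣ curveMap a k H G l - curveVert a k H * C ((![1, 0, 2] : Fin 3 → K) l)
    rw [curveMap]
    generalize curveDenom a k H = W at *
    generalize curveVert a k H = V at *
    generalize curveNumer a H * G = U at *
    fin_cases l
    · simpa using hGW
    · simpa using hGU.mul_left _
    · simp [mul_comm]
  · change midFactor a H i ∣
      curveMap a k H G l - C 2 * curveVert a k H * C ((![1, a i, 1] : Fin 3 → K) l)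
    rw [curveMap]
    replace hMV := hMV i
    replace hUa := hUa i
    generalize curveDenom a k H = W at *
    generalize curveVert a k H = V at *
    generalize curveNumer a H * G = U at *
    fin_cases l
    · convert hMV using 1
      simp [c2]; ring
    · have : C 2 * U - C 2 * V * C (a i) =
        midFactor a H i * (2 * (X - C (a i)) * G) + 2 * C (a i) * (W - V) := by
        rw [c2]; linear_combination 2 * hUa
      change _ ∣ C 2 * U - C 2 * V * C (a i)
      rw [this]
      exact dvd_add (Dvd.intro _ rfl) (hMV.mul_left _)
    · simp
  · change X - C (a i) ∣
      curveMap a k H G l - curveDenom a k H * C ((![1, 2 * a i, 0] : Fin 3 → K) l)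
    rw [curveMap]
    replace hXV := hXV i
    replace hUa := hUa i
    generalize curveDenom a k H = W at *
    generalize curveVert a k H = V at *
    generalize curveNumer a H * G = U at *
    fin_cases l
    · simpa using hXV
    · change _ ∣ C 2 * U - W * C (2 * a i)
      refine ⟨2 * midFactor a H i * G, ?_⟩
      rw [C_mul, c2]; linear_combination 2 * hUa
    · simpa using hXV.mul_left _
  · change fiberPoly a H (k j) ∣
      curveMap a k H G l - curveDenom a k H * C ((![1, 2 * k j, 0] : Fin 3 → K) l)
    rw [curveMap]
    replace hOV := hOV j
    replace hUx := hUx (k j)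
    generalize curveDenom a k H = W at *
    generalize curveVert a k H = V at *
    generalize curveNumer a H * G = U at *
    fin_cases l
    · simpa using hOV
    · change _ ∣ C 2 * U - W * C (2 * k j)
      refine ⟨2 * G, ?_⟩
      rw [C_mul, c2]; linear_combination 2 * hUx
    · simpa using hOV.mul_left _

/-- The prescribed value of `H` at `s` gives `U / W = u` there, and `huv` then gives `V / W = v`.
The curve thus passes through a point where `f` does not vanish. -/
theorem aeval_curveMap_ne_zero (hG : curveDenom a k H = H * G)
    {f : MvPolynomial (Fin 3) K} {d : ℕ} (hf : f.IsHomogeneous d) {u v s : K}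
    (huk : ∀ i, u ≠ k i) (hs : (nodePoly a).eval s ≠ 0) (hus : u ≠ s)
    (hHs : H.eval s = (nodePoly a).eval s ^ 2 / (u - s))
    (huv : (v - 1) * (u - s) * ∏ i, (u - k i) = v * ∏ i, (u - a i))
    (hfe : MvPolynomial.eval ![1 + v, 2 * u, 2 * v] f ≠ 0) :
    MvPolynomial.aeval (curveMap a k H G) f ≠ 0 := by
  have hUx := numer_sub_denom hG u
  have hWV : curveDenom a k H = curveVert a k H - ∏ i, midFactor a H i := rfl
  have hR0 : ∏ i, (u - k i) ≠ 0 := Finset.prod_ne_zero_iff.2 fun i _ => sub_ne_zero.2 (huk i)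
  have hηε : (nodePoly a).eval s ^ 2 = H.eval s * (u - s) := by
    rw [hHs, div_mul_cancel₀ _ (sub_ne_zero.2 hus)]
  have hη0 : H.eval s ≠ 0 := by
    rw [hHs]
    exact div_ne_zero (pow_ne_zero 2 hs) (sub_ne_zero.2 hus)
  have eF : ∀ x, (fiberPoly a H x).eval s = H.eval s * (u - x) := by
    intro x
    rw [eval_fiberPoly, hηε]; ring
  have eV : (curveVert a k H).eval s =
      (nodePoly a).eval s * (H.eval s ^ n * ∏ i, (u - k i)) := by
    simp only [curveVert, eval_mul, eval_prod, eF, Finset.prod_mul_distrib, Finset.prod_const,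
      Finset.card_univ, Fintype.card_fin]
  have eM : (nodePoly a).eval s * (∏ i, midFactor a H i).eval s =
      H.eval s ^ (n + 1) * ∏ i, (u - a i) := by
    have h : ∀ i, (s - a i) * (midFactor a H i).eval s = H.eval s * (u - a i) := fun i => by
      rw [eval_midFactor, eF]
    have h1 : (nodePoly a).eval s = ∏ i, (s - a i) := by simp [nodePoly, eval_prod]
    rw [h1, eval_prod, ← Finset.prod_mul_distrib, Finset.prod_congr rfl fun i _ => h i,
      Finset.prod_mul_distrib]
    simp
  unfold curveMap
  generalize curveDenom a k H = W at *
  generalize curveVert a k H = V at *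
  generalize curveNumer a H * G = U at *
  generalize ∏ i, midFactor a H i = M at *
  generalize (nodePoly a).eval s = ε at *
  generalize ∏ i, (u - k i) = R at *
  generalize ∏ i, (u - a i) = P at *
  clear hHs
  generalize H.eval s = η at *
  have eVW : V.eval s = v * W.eval s := by
    have h : ε * ((v - 1) * V.eval s) = ε * (v * M.eval s) := by
      calc ε * ((v - 1) * V.eval s) = ε ^ 2 * η ^ n * R * (v - 1) := by rw [eV]; ring
        _ = η ^ (n + 1) * ((v - 1) * (u - s) * R) := by rw [hηε]; ring
        _ = v * (ε * M.eval s) := by rw [huv, eM]; ring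
        _ = _ := by ring
    have h1 := mul_left_cancel₀ hs h
    rw [hWV, eval_sub]
    linear_combination -h1
  have eV0 : V.eval s ≠ 0 := by
    rw [eV]
    exact mul_ne_zero hs (mul_ne_zero (pow_ne_zero _ hη0) hR0)
  have eW0 : W.eval s ≠ 0 := by
    intro h
    rw [h, mul_zero] at eVW
    exact eV0 eVW
  have eU : U.eval s = u * W.eval s := by
    have := congrArg (eval s) hUx
    rwa [eval_mul, eF, sub_self, mul_zero, zero_mul, eval_sub, eval_mul, eval_C, sub_eq_zero]
      at this
  intro h
  have h1 := congrArg (eval s) h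
  rw [eval_aeval_mvPolynomial, eval_zero] at h1
  have h2 : (fun i => ((![W + V, C 2 * U, C 2 * V] : Fin 3 → K[X]) i).eval s) =
      fun i => W.eval s * (![1 + v, 2 * u, 2 * v] : Fin 3 → K) i := by
    ext i
    fin_cases i
    · simp [eVW]; ring
    · simp [eU]; ring
    · simp [eVW]; ring
  rw [h2, ← MvPolynomial.coe_aeval_eq_eval] at h1
  change MvPolynomial.aeval _ f = 0 at h1
  rw [aeval_mul_left_of_isHomogeneous _ _ hf] at h1
  exact mul_ne_zero (pow_ne_zero _ eW0) hfe h1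

end Factors

end RationalCurve

/-! ### Existence of the curve and the lower bound. -/

section RationalCurve

open Polynomial

variable {K : Type*} [Field K] {n : ℕ} {a : Fin (n + 1) → K} {k : Fin n → K}

theorem exists_curve [IsAlgClosed K] [CharZero K] (hn : 1 ≤ n) (ha : Function.Injective a)
    (hk : Function.Injective k) (hak : ∀ i j, a i ≠ k j) {f : MvPolynomial (Fin 3) K} {d : ℕ}
    (hf : f.IsHomogeneous d) (hf0 : f ≠ 0) :
    ∃ (φ : Fin 3 → K[X]) (g c : PointIndex n → K[X]),
      (∀ i, (φ i).natDegree ≤ 2 * n * (n + 1)) ∧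
      ∑ p, (g p).natDegree + 1 = 6 * n ^ 2 + 4 * n ∧ Pairwise (Function.onFun IsCoprime g) ∧
      (∀ p, g p ≠ 0) ∧ (∀ p, IsCoprime (c p) (g p)) ∧
      (∀ p i, g p ∣ φ i - c p * C (pointVec a k p i)) ∧ MvPolynomial.aeval φ f ≠ 0 := by
  classical
  obtain ⟨u, v, s, hua, huk, hv0, hv1, hsa, huv, hfe⟩ := exists_general_point a k hf hf0
  have j₀ : Fin n := ⟨0, hn⟩
  set R := ∏ i, (u - k i) with hR
  set P := ∏ i, (u - a i) with hP
  have hP0 : P ≠ 0 := Finset.prod_ne_zero_iff.2 fun i _ => sub_ne_zero.2 (hua i)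
  have hR0 : R ≠ 0 := Finset.prod_ne_zero_iff.2 fun i _ => sub_ne_zero.2 (huk i)
  have hus : u - s ≠ 0 := by
    intro h
    rw [h, mul_zero, zero_mul] at huv
    exact mul_ne_zero hv0 hP0 huv.symm
  set ε := (nodePoly a).eval s with hε
  have hε0 : ε ≠ 0 := by
    rw [hε, Ne, eval_nodePoly_eq_zero_iff]
    rintro ⟨i, hi⟩
    exact hsa i hi
  set η := ε ^ 2 / (u - s) with hη
  have hη0 : η ≠ 0 := div_ne_zero (pow_ne_zero 2 hε0) hus
  have hηε : ε ^ 2 = η * (u - s) := by rw [hη, div_mul_cancel₀ _ hus]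
  set ρ := ∏ j ∈ Finset.univ.erase j₀, (k j - k j₀) with hρ
  have hρ0 : ρ ≠ 0 := Finset.prod_ne_zero_iff.2 fun j hj =>
    sub_ne_zero.2 (hk.ne (Finset.ne_of_mem_erase hj))
  -- `e₁` makes the projection equal to `k j₀` at infinity. The next coefficient of `H` must avoid
  -- `e₂`, where the fiber over `k j₀` would lose a second root, and `e₂ + ∏ (a i - k j₀) / ρ`,
  -- where the denominator would drop degree.
  set e₁ := -(nodePoly a ^ 2).coeff (2 * n + 1) - k j₀ with he₁
  set e₂ := k j₀ * e₁ - (nodePoly a ^ 2).coeff (2 * n) with he₂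
  obtain ⟨H, hHd, hc, hc', hB, hHs, hHa⟩ : ∃ H : K[X], H.natDegree ≤ 2 * n + 1 ∧
      H.coeff (2 * n + 1) = -1 ∧ H.coeff (2 * n) = e₁ ∧
      H.coeff (2 * n - 1) ∉ ({e₂, e₂ + (∏ i, (a i - k j₀)) / ρ} : Finset K) ∧
      H.eval s = η ∧ ∀ i, H.eval (a i) ≠ 0 := by
    obtain ⟨m, rfl⟩ : ∃ m, n = m + 1 := ⟨n - 1, by omega⟩
    exact exists_interpolant m a (fun i => hak i j₀) hsa η e₁ _
  rw [Finset.mem_insert, Finset.mem_singleton, not_or] at hB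
  have hco : (fiberPoly a H (k j₀)).coeff (2 * n) = H.coeff (2 * n - 1) - e₂ := by
    obtain ⟨m, hm⟩ : ∃ m, 2 * n = m + 1 := ⟨2 * n - 1, by omega⟩
    rw [he₂, ← hc', hm, coeff_fiberPoly, Nat.add_sub_cancel]
    ring
  obtain ⟨d₀, dO, dV, dW⟩ := natDegree_curveDenom (j₀ := j₀) hk hak hHd hc hc'
    (by rw [hco]; exact sub_ne_zero.2 hB.1)
    (by
      rw [hco, ← hρ]
      intro h
      exact hB.2 (by rw [← h]; field_simp; ring))
  have dM : ∀ i, (midFactor a H i).natDegree = 2 * n := fun i =>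
    (natDegree_midFactor hHd hc hc' (hak i j₀)).1
  have dH : H.natDegree = 2 * n + 1 :=
    natDegree_eq_of_le_of_coeff_ne_zero hHd (by rw [hc]; exact neg_ne_zero.2 one_ne_zero)
  have hn' : 0 < 2 * n * (n + 1) := by positivity
  have hW0 : curveDenom a k H ≠ 0 := by
    intro h
    rw [h, natDegree_zero] at dW
    omega
  obtain ⟨G, hG⟩ := dvd_curveDenom (a := a) (k := k) (H := H)
  have hG0 : G ≠ 0 := by rintro rfl; exact hW0 (by rw [hG, mul_zero])
  have hH0 : H ≠ 0 := by rintro rfl; exact hW0 (by rw [hG, zero_mul])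
  have dG : G.natDegree + (2 * n + 1) = 2 * n * (n + 1) := by
    rw [← dW, hG, natDegree_mul hH0 hG0, dH, add_comm]
  refine ⟨curveMap a k H G, curveFactor a k H G, curveScale a k H, ?_, ?_,
    pairwise_isCoprime_curveFactor ha hk hHa hak hG, curveFactor_ne_zero hHa hak hG0,
    isCoprime_curveScale_curveFactor hHa hak hG, curveFactor_dvd hG,
    aeval_curveMap_ne_zero hG hf huk hε0 (sub_ne_zero.1 hus) hHs huv hfe⟩
  -- Comparing with the fiber over `k j₀`, of degree `2n`, avoids estimating the numerator directly.
  · have dU : (curveNumer a H * G).natDegree ≤ 2 * n * (n + 1) := by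
      have h1 : curveNumer a H * G =
          fiberPoly a H (k j₀) * G + C (k j₀) * curveDenom a k H := by
        rw [← numer_sub_denom hG]; ring
      rw [h1]
      refine natDegree_add_le_of_degree_le (natDegree_mul_le.trans ?_)
        ((natDegree_C_mul_le _ _).trans dW.le)
      omega
    intro i
    fin_cases i
    · exact natDegree_add_le_of_degree_le dW.le dV
    · exact (natDegree_C_mul_le _ _).trans dU
    · exact (natDegree_C_mul_le _ _).trans dV
  · simp only [curveFactor, Fintype.sum_sum_type, Sum.elim_inl, Sum.elim_inr, dM,
      natDegree_X_sub_C, Finset.sum_const, Finset.card_univ, Fintype.card_fin, smul_eq_mul,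
      Finset.card_singleton, Finset.univ_unique, one_mul]
    nlinarith

theorem mul_le_degree_of_mem_symbolicPower [IsAlgClosed K] [CharZero K] (hn : 1 ≤ n)
    (ha : Function.Injective a) (hk : Function.Injective k) (hak : ∀ i j, a i ≠ k j)
    {f : MvPolynomial (Fin 3) K} {d t : ℕ} (hf : f.IsHomogeneous d) (hf0 : f ≠ 0)
    (hft : ∀ p, ∃ s, s ∉ lineIdeal (pointVec a k p) ∧ s * f ∈ lineIdeal (pointVec a k p) ^ t) :
    (6 * n ^ 2 + 4 * n - 1) * t ≤ d * (2 * n * (n + 1)) := by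
  obtain ⟨φ, g, c, hφ, hdeg, hpair, hg, hcop, hdvd, hne⟩ := exists_curve hn ha hk hak hf hf0
  have h : ∏ p, g p ^ t ∣ MvPolynomial.aeval φ f := by
    refine Fintype.prod_dvd_of_coprime (fun p q hpq => (hpair hpq).pow) fun p => ?_
    obtain ⟨s, hs, hsf⟩ := hft p
    exact pow_dvd_aeval_of_mul_mem_pow (hg p) (hcop p) (hdvd p) hf hs hsf
  have h1 := (natDegree_le_of_dvd h hne).trans (natDegree_aeval_le_of_isHomogeneous hφ hf)
  rw [natDegree_prod _ _ fun p _ => pow_ne_zero _ (hg p)] at h1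
  simp only [natDegree_pow] at h1
  rw [← Finset.mul_sum] at h1
  rw [show 6 * n ^ 2 + 4 * n - 1 = ∑ p, (g p).natDegree by omega, mul_comm]
  exact h1

end RationalCurve

/-! ### The extremal form and the upper bound. -/

section ExtremalForm

open MvPolynomial

variable {K : Type*} [Field K] {n : ℕ} {a : Fin (n + 1) → K} {k : Fin n → K}

theorem mem_lineIdeal_of_isHomogeneous [Infinite K] {σ : Type*} {v : σ → K}
    {f : MvPolynomial σ K} {d : ℕ} (hf : f.IsHomogeneous d) (h : eval v f = 0) :
    f ∈ lineIdeal v := by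
  rw [mem_lineIdeal_iff]
  intro c _
  refine (aeval_mul_left_of_isHomogeneous c v hf).trans ?_
  change c ^ d * eval v f = 0
  rw [h, mul_zero]

theorem prod_mem_pow_mul_card {R ι : Type*} [CommRing R] {I : Ideal R} {s : Finset ι} {f : ι → R}
    {e : ℕ} (h : ∀ i ∈ s, f i ∈ I ^ e) : ∏ i ∈ s, f i ∈ I ^ (e * s.card) := by
  have := Ideal.prod_mem_prod h
  rwa [Finset.prod_const, ← pow_mul] at this

/-- The line through `[1 : 0 : 2]` and `[1 : 2 * x : 0]`. -/
noncomputable def apexLine (x : K) : MvPolynomial (Fin 3) K := X 1 - C x * (C 2 * X 0 - X 2)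

theorem isHomogeneous_apexLine (x : K) : (apexLine x).IsHomogeneous 1 := by
  refine (isHomogeneous_X _ _).sub ?_
  have h : (C 2 * X 0 - X 2 : MvPolynomial (Fin 3) K).IsHomogeneous 1 := by
    refine IsHomogeneous.sub ?_ (isHomogeneous_X _ _)
    simpa using (isHomogeneous_C (Fin 3) (2 : K)).mul (isHomogeneous_X K (0 : Fin 3))
  simpa using (isHomogeneous_C (Fin 3) x).mul h

theorem eval_apexLine (x : K) (v : Fin 3 → K) :
    eval v (apexLine x) = v 1 - x * (2 * v 0 - v 2) := by
  simp [apexLine]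

/-- A form of degree `n` with a point of multiplicity `n - 1` at `[1 : 0 : 2]` that passes through
the odd points and all points of the middle row but the one with index `l`. -/
noncomputable def rowForm (a : Fin (n + 1) → K) (k : Fin n → K) (l : Fin (n + 1)) :
    MvPolynomial (Fin 3) K :=
  ∏ j, apexLine (k j) + X 2 * ∑ i ∈ Finset.univ.erase l,
    C (-(∏ j, (a i - k j)) / ∏ j ∈ (Finset.univ.erase l).erase i, (a i - a j)) *
      ∏ j ∈ (Finset.univ.erase l).erase i, apexLine (a j)

theorem card_erase_erase {l i : Fin (n + 1)} (hi : i ∈ Finset.univ.erase l) :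
    ((Finset.univ.erase l).erase i).card = n - 1 := by
  rw [Finset.card_erase_of_mem hi, Finset.card_erase_of_mem (Finset.mem_univ l)]
  simp

theorem isHomogeneous_rowForm (hn : 1 ≤ n) (l : Fin (n + 1)) :
    (rowForm a k l).IsHomogeneous n := by
  refine IsHomogeneous.add ?_ ?_
  · simpa using IsHomogeneous.prod Finset.univ (fun j => apexLine (k j)) (fun _ => 1)
      fun j _ => isHomogeneous_apexLine (k j)
  · have hX : ∀ f : MvPolynomial (Fin 3) K, f.IsHomogeneous (n - 1) →
        (X 2 * f).IsHomogeneous n := fun f hf => by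
      have := (isHomogeneous_X K (2 : Fin 3)).mul hf
      rwa [Nat.add_sub_of_le hn] at this
    refine hX _ (IsHomogeneous.sum _ _ _ fun i hi => ?_)
    have h1 := IsHomogeneous.prod ((Finset.univ.erase l).erase i) (fun j => apexLine (a j))
      (fun _ => 1) fun j _ => isHomogeneous_apexLine (a j)
    rw [Finset.sum_const, card_erase_erase hi, smul_eq_mul, mul_one] at h1
    simpa using (isHomogeneous_C (Fin 3) (-(∏ j, (a i - k j)) /
      ∏ j ∈ (Finset.univ.erase l).erase i, (a i - a j))).mul h1

/-- On the middle row `2x₀ - x₂ = x₂ = 1`, so the second summand of `rowForm` is the Lagrange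
interpolant of minus the first at the nodes other than `a l`. -/
theorem eval_rowForm_middle (ha : Function.Injective a) {l i : Fin (n + 1)} (hi : i ≠ l) :
    eval ![1, a i, 1] (rowForm a k l) = 0 := by
  have e : ∀ x : K, eval ![1, a i, 1] (apexLine x) = a i - x := by
    intro x
    rw [eval_apexLine]; simp; ring
  have hi' : i ∈ Finset.univ.erase l := Finset.mem_erase.2 ⟨hi, Finset.mem_univ i⟩
  have h0 : ∏ j ∈ (Finset.univ.erase l).erase i, (a i - a j) ≠ 0 :=
    Finset.prod_ne_zero_iff.2 fun j hj => sub_ne_zero.2 (ha.ne (Finset.ne_of_mem_erase hj).symm)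
  simp only [rowForm, map_add, map_mul, map_prod, map_sum, e, eval_C, eval_X]
  rw [Finset.sum_eq_single_of_mem i hi', div_mul_cancel₀ _ h0]
  · simp
  · intro j hj hji
    exact mul_eq_zero_of_right _
      (Finset.prod_eq_zero (Finset.mem_erase.2 ⟨hji.symm, hi'⟩) (sub_self _))

theorem eval_rowForm_odd (j : Fin n) (l : Fin (n + 1)) :
    eval ![1, 2 * k j, 0] (rowForm a k l) = 0 := by
  have h : eval ![1, 2 * k j, 0] (∏ j, apexLine (k j)) = 0 := by
    rw [map_prod]
    refine Finset.prod_eq_zero (Finset.mem_univ j) ?_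
    rw [eval_apexLine]; simp; ring
  rw [rowForm, map_add, h, map_mul, eval_X]
  simp

theorem rowForm_ne_zero (l : Fin (n + 1)) : rowForm a k l ≠ 0 := by
  intro h
  have h1 := congrArg (eval ![0, 1, 0]) h
  simp [rowForm, map_prod, eval_apexLine] at h1

theorem apexLine_ne_zero (x : K) : apexLine x ≠ 0 := by
  intro h
  have h1 := congrArg (eval ![0, 1, 0]) h
  simp [eval_apexLine] at h1

theorem apexLine_mem_lineIdeal [Infinite K] (x : K) {v : Fin 3 → K}
    (h : v 1 - x * (2 * v 0 - v 2) = 0) : apexLine x ∈ lineIdeal v :=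
  mem_lineIdeal_of_isHomogeneous (isHomogeneous_apexLine x) (by rw [eval_apexLine, h])

theorem rowForm_mem_pow [Infinite K] (l : Fin (n + 1)) :
    rowForm a k l ∈ lineIdeal (![1, 0, 2] : Fin 3 → K) ^ (n - 1) := by
  have h : ∀ x : K, apexLine x ∈ lineIdeal (![1, 0, 2] : Fin 3 → K) ^ 1 := fun x => by
    rw [pow_one]
    exact apexLine_mem_lineIdeal x (by simp)
  refine Ideal.add_mem _ ?_ (Ideal.mul_mem_left _ _ (Ideal.sum_mem _ fun i hi =>
    Ideal.mul_mem_left _ _ ?_))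
  · have h1 := prod_mem_pow_mul_card (s := Finset.univ) fun j (_ : j ∈ Finset.univ) => h (k j)
    refine Ideal.pow_le_pow_right ?_ h1
    simp
  · have h1 := prod_mem_pow_mul_card (s := (Finset.univ.erase l).erase i)
      fun j (_ : j ∈ (Finset.univ.erase l).erase i) => h (a j)
    rwa [card_erase_erase hi, one_mul] at h1

/-- A form that computes the Waldschmidt constant. -/
noncomputable def extremalForm (a : Fin (n + 1) → K) (k : Fin n → K) : MvPolynomial (Fin 3) K :=
  X 2 ^ (2 * n * (n + 1) - (n + 1)) * (X 0 - X 2) ^ (2 * n * (n + 1) - (2 * n + 1)) *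
    (∏ i, apexLine (a i) ^ (n + 1)) * ∏ l, rowForm a k l

theorem extremalForm_ne_zero : extremalForm a k ≠ 0 := by
  have h : (X 0 - X 2 : MvPolynomial (Fin 3) K) ≠ 0 := by
    intro h
    have h1 := congrArg (eval ![1, 0, 0]) h
    simp at h1
  exact mul_ne_zero (mul_ne_zero (mul_ne_zero (pow_ne_zero _ (X_ne_zero _)) (pow_ne_zero _ h))
    (Finset.prod_ne_zero_iff.2 fun i _ => pow_ne_zero _ (apexLine_ne_zero _)))
    (Finset.prod_ne_zero_iff.2 fun l _ => rowForm_ne_zero l)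

theorem isHomogeneous_extremalForm (hn : 1 ≤ n) :
    (extremalForm a k).IsHomogeneous (6 * n ^ 2 + 4 * n - 1) := by
  have h1 := (isHomogeneous_X K (2 : Fin 3)).pow (2 * n * (n + 1) - (n + 1))
  have h2 := ((isHomogeneous_X K (0 : Fin 3)).sub (isHomogeneous_X K (2 : Fin 3))).pow
    (2 * n * (n + 1) - (2 * n + 1))
  have h3 := IsHomogeneous.prod Finset.univ (fun i => apexLine (a i) ^ (n + 1)) _
    fun i _ => (isHomogeneous_apexLine (a i)).pow (n + 1)
  have h4 := IsHomogeneous.prod Finset.univ (fun l => rowForm a k l) _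
    fun l _ => isHomogeneous_rowForm hn l
  have h := ((h1.mul h2).mul h3).mul h4
  refine (show _ = 6 * n ^ 2 + 4 * n - 1 from ?_) ▸ h
  obtain ⟨m, rfl⟩ : ∃ m, n = m + 1 := ⟨n - 1, by omega⟩
  have e1 : 2 * (m + 1) * (m + 1 + 1) - (m + 1 + 1) = 2 * m ^ 2 + 5 * m + 2 := by
    rw [Nat.sub_eq_iff_eq_add (by nlinarith)]; ring
  have e2 : 2 * (m + 1) * (m + 1 + 1) - (2 * (m + 1) + 1) = 2 * m ^ 2 + 4 * m + 1 := by
    rw [Nat.sub_eq_iff_eq_add (by nlinarith)]; ring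
  rw [e1, e2]
  simp only [Finset.sum_const, Finset.card_univ, Fintype.card_fin, smul_eq_mul, one_mul]
  refine Nat.eq_sub_of_add_eq ?_
  ring

/-- The multiplicities add up to `T` as follows: `(n+1)² + (n+1)(n-1)` at the top from the apex
lines and row forms; `T - (2n+1)`, `n+1` and `n` at a middle point from its row, its apex line and
the `n` row forms through it; `T - (n+1)` from the bottom row at a bottom point, completed by its
apex line if even and by all the row forms if odd. -/
theorem extremalForm_mem_pow [Infinite K] (hn : 1 ≤ n) (ha : Function.Injective a)
    (p : PointIndex n) : extremalForm a k ∈ lineIdeal (pointVec a k p) ^ (2 * n * (n + 1)) := by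
  have hX2 : ∀ x : K, (X 2 : MvPolynomial (Fin 3) K) ∈ lineIdeal ![1, x, 0] := fun x =>
    mem_lineIdeal_of_isHomogeneous (isHomogeneous_X _ _) (by simp)
  have hsub : ∀ x : K, (X 0 - X 2 : MvPolynomial (Fin 3) K) ∈ lineIdeal ![1, x, 1] := fun x =>
    mem_lineIdeal_of_isHomogeneous ((isHomogeneous_X _ _).sub (isHomogeneous_X _ _)) (by simp)
  have hmul : ∀ {I : Ideal (MvPolynomial (Fin 3) K)} {x y : MvPolynomial (Fin 3) K} {r s : ℕ},
      x ∈ I ^ r → y ∈ I ^ s → x * y ∈ I ^ (r + s) := fun hx hy => by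
    rw [pow_add]; exact Ideal.mul_mem_mul hx hy
  have h1 : n + 1 ≤ 2 * n * (n + 1) := by nlinarith
  have h2 : 2 * n + 1 ≤ 2 * n * (n + 1) := by nlinarith
  rcases p with _ | i | i | j
  · change extremalForm a k ∈ lineIdeal (![1, 0, 2] : Fin 3 → K) ^ (2 * n * (n + 1))
    have h3 := prod_mem_pow_mul_card (s := Finset.univ) fun i (_ : i ∈ Finset.univ) =>
      Ideal.pow_mem_pow (apexLine_mem_lineIdeal (a i) (v := ![1, 0, 2]) (by simp)) (n + 1)
    have h4 := prod_mem_pow_mul_card (s := Finset.univ) fun l (_ : l ∈ Finset.univ) =>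
      rowForm_mem_pow (a := a) (k := k) l
    have h := hmul h3 h4
    refine Ideal.mem_of_dvd _ (mul_dvd_mul (Dvd.intro_left _ rfl) dvd_rfl)
      (Ideal.pow_le_pow_right ?_ h)
    obtain ⟨m, rfl⟩ : ∃ m, n = m + 1 := ⟨n - 1, by omega⟩
    simp only [Finset.card_univ, Fintype.card_fin, Nat.add_sub_cancel]
    nlinarith
  · change extremalForm a k ∈ lineIdeal (![1, a i, 1] : Fin 3 → K) ^ (2 * n * (n + 1))
    have h3 := Ideal.pow_mem_pow (hsub (a i)) (2 * n * (n + 1) - (2 * n + 1))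
    have h4 := Ideal.pow_mem_pow (apexLine_mem_lineIdeal (a i) (v := ![1, a i, 1])
      (by simp; ring)) (n + 1)
    have h5 := prod_mem_pow_mul_card (e := 1) (s := Finset.univ.erase i) (f := rowForm a k)
      (I := lineIdeal (![1, a i, 1] : Fin 3 → K)) fun l hl => by
        rw [pow_one]
        exact mem_lineIdeal_of_isHomogeneous (isHomogeneous_rowForm hn l)
          (eval_rowForm_middle ha (Finset.ne_of_mem_erase hl).symm)
    have h := hmul (hmul h3 h4) h5
    rw [Finset.card_erase_of_mem (Finset.mem_univ i), Finset.card_univ, Fintype.card_fin] at h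
    rw [show 2 * n * (n + 1) = 2 * n * (n + 1) - (2 * n + 1) + (n + 1) + 1 * (n + 1 - 1) by omega]
    refine Ideal.mem_of_dvd _ ?_ h
    rw [extremalForm]
    refine mul_dvd_mul (mul_dvd_mul (Dvd.intro_left _ rfl) ?_)
      (Finset.prod_dvd_prod_of_subset _ _ _ (Finset.erase_subset _ _))
    exact Finset.dvd_prod_of_mem (fun i => apexLine (a i) ^ (n + 1)) (Finset.mem_univ i)
  · change extremalForm a k ∈ lineIdeal (![1, 2 * a i, 0] : Fin 3 → K) ^ (2 * n * (n + 1))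
    have h3 := Ideal.pow_mem_pow (hX2 (2 * a i)) (2 * n * (n + 1) - (n + 1))
    have h4 := Ideal.pow_mem_pow (apexLine_mem_lineIdeal (a i) (v := ![1, 2 * a i, 0])
      (by simp; ring)) (n + 1)
    have h := hmul h3 h4
    rw [Nat.sub_add_cancel h1] at h
    refine Ideal.mem_of_dvd _ ?_ h
    rw [extremalForm]
    refine Dvd.dvd.mul_right (mul_dvd_mul (Dvd.intro _ rfl) ?_) _
    exact Finset.dvd_prod_of_mem (fun i => apexLine (a i) ^ (n + 1)) (Finset.mem_univ i)
  · change extremalForm a k ∈ lineIdeal (![1, 2 * k j, 0] : Fin 3 → K) ^ (2 * n * (n + 1))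
    have h3 := Ideal.pow_mem_pow (hX2 (2 * k j)) (2 * n * (n + 1) - (n + 1))
    have h4 := prod_mem_pow_mul_card (e := 1) (s := Finset.univ) (f := rowForm a k)
      (I := lineIdeal (![1, 2 * k j, 0] : Fin 3 → K)) fun l _ => by
        rw [pow_one]
        exact mem_lineIdeal_of_isHomogeneous (isHomogeneous_rowForm hn l) (eval_rowForm_odd j l)
    have h := hmul h3 h4
    rw [Finset.card_univ, Fintype.card_fin, one_mul, Nat.sub_add_cancel h1] at h
    refine Ideal.mem_of_dvd _ ?_ h
    rw [extremalForm]
    exact mul_dvd_mul (Dvd.dvd.mul_right (Dvd.intro _ rfl) _) dvd_rfl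

end ExtremalForm

/-! ### The configuration, its ideal and the limit. -/

section Configuration

variable {K : Type*} [Field K] {n : ℕ} {a : Fin (n + 1) → K} {k : Fin n → K}

theorem pointVec_zero (p : PointIndex n) : pointVec a k p 0 = 1 := by
  rcases p with _ | i | i | j <;> rfl

theorem pointVec_ne_zero (p : PointIndex n) : pointVec a k p ≠ 0 := fun h =>
  one_ne_zero ((pointVec_zero p).symm.trans (congrFun h 0))

theorem pointVec_injective [CharZero K] (ha : Function.Injective a) (hk : Function.Injective k)
    (hak : ∀ i j, a i ≠ k j) : Function.Injective (pointVec a k) := by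
  have two : (2 : K) ≠ 0 := two_ne_zero
  have two' : (2 : K) ≠ 1 := by norm_num
  rintro (_ | i | i | i) (_ | j | j | j) h
  all_goals
    have h1 := congrFun h 1
    have h2 := congrFun h 2
    simp [pointVec, two, two', two.symm, two'.symm, ha.eq_iff, hk.eq_iff, hak,
      fun i j => (hak i j).symm] at h1 h2
  all_goals simp_all

theorem not_lineIdeal_le [Infinite K] [CharZero K] (ha : Function.Injective a)
    (hk : Function.Injective k) (hak : ∀ i j, a i ≠ k j) (p q : PointIndex n) (hpq : p ≠ q) :
    ¬ lineIdeal (pointVec a k p) ≤ lineIdeal (pointVec a k q) := by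
  intro h
  refine hpq (pointVec_injective ha hk hak (funext fun l => ?_))
  -- As all points have first coordinate `1`, these linear forms recover the coordinates of `p` from
  -- its ideal.
  have hf : (MvPolynomial.X l - MvPolynomial.C (pointVec a k p l) * MvPolynomial.X 0 :
      MvPolynomial (Fin 3) K) ∈ lineIdeal (pointVec a k p) := by
    rw [mem_lineIdeal_iff]
    intro c _
    simp [pointVec_zero]; ring
  have := mem_lineIdeal_iff.1 (h hf) 1 one_ne_zero
  simp [pointVec_zero] at this
  exact (sub_eq_zero.1 this).symm

theorem pointsIdeal_range [Infinite K] {ι : Type*} (v : ι → Fin 3 → K) (hv : ∀ i, v i ≠ 0) :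
    pointsIdeal (Set.range fun i => Projectivization.mk K (v i) (hv i)) =
      ⨅ i, lineIdeal (v i) := by
  ext f
  rw [Submodule.mem_iInf, pointsIdeal, MvPolynomial.mem_vanishingIdeal_iff]
  simp only [mem_lineIdeal_iff]
  constructor
  · intro h i c hc
    refine h _ ⟨smul_ne_zero hc (hv i), i, ?_⟩
    exact ((Projectivization.mk_eq_mk_iff' K _ _ _ _).2 ⟨c, rfl⟩).symm
  · rintro h x ⟨hx, i, hi⟩
    obtain ⟨c, hc⟩ := (Projectivization.mk_eq_mk_iff' K _ _ _ _).1 hi.symm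
    rw [← hc]
    refine h i c ?_
    rintro rfl
    exact hx (by rw [← hc, zero_smul])

theorem isWaldschmidtConstant_pointsIdeal [IsAlgClosed K] [CharZero K] (hn : 1 ≤ n)
    (ha : Function.Injective a) (hk : Function.Injective k) (hak : ∀ i j, a i ≠ k j) :
    IsWaldschmidtConstant (⨅ p, lineIdeal (pointVec a k p))
      (((6 * n ^ 2 + 4 * n - 1 : ℕ) : ℝ) / ((2 * n * (n + 1) : ℕ) : ℝ)) := by
  have hinf : Infinite K := IsAlgClosed.instInfinite
  have hinc := not_lineIdeal_le ha hk hak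
  have hT : 0 < 2 * n * (n + 1) := by positivity
  set T := 2 * n * (n + 1) with hTdef
  set D := 6 * n ^ 2 + 4 * n - 1 with hD
  set I := ⨅ p, lineIdeal (pointVec a k p) with hI
  -- The power `t / T + 1` of the extremal form has multiplicity at least `t`; rounding costs at
  -- most `D * T`, which disappears after division by `t`.
  have key : ∀ t, D * t ≤ initialDegree (symbolicPower I t) * T ∧
      initialDegree (symbolicPower I t) * T ≤ D * t + D * T := by
    intro t
    have hmem : D * (t / T + 1) ∈
        {d : ℕ | ∃ f ∈ symbolicPower I t, f ≠ 0 ∧ f.IsHomogeneous d} := by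
      refine ⟨extremalForm a k ^ (t / T + 1), mem_symbolicPower_iInf hinc fun p => ?_,
        pow_ne_zero _ extremalForm_ne_zero, (isHomogeneous_extremalForm hn).pow _⟩
      have h := Ideal.pow_mem_pow (extremalForm_mem_pow (k := k) hn ha p) (t / T + 1)
      rw [← pow_mul] at h
      exact Ideal.pow_le_pow_right (Nat.lt_mul_div_succ t hT).le h
    constructor
    · obtain ⟨f, hf, hf0, hfd⟩ := Nat.sInf_mem ⟨_, hmem⟩
      exact mul_le_degree_of_mem_symbolicPower hn ha hk hak hfd hf0 fun p =>
        exists_mul_mem_pow_of_mem_symbolicPower_iInf hinc hf p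
    · calc initialDegree (symbolicPower I t) * T ≤ D * (t / T + 1) * T :=
            Nat.mul_le_mul_right _ (Nat.sInf_le hmem)
        _ = D * (t / T * T) + D * T := by ring
        _ ≤ D * t + D * T := by gcongr; exact Nat.div_mul_le_self t T
  have hT' : (0 : ℝ) < T := by exact_mod_cast hT
  have hlim : Tendsto (fun t : ℕ => (D : ℝ) / T + D / t) atTop (𝓝 ((D : ℝ) / T)) := by
    simpa using tendsto_const_nhds.add (tendsto_const_div_atTop_nhds_zero_nat (D : ℝ))
  refine tendsto_of_tendsto_of_tendsto_of_le_of_le' tendsto_const_nhds hlim ?_ ?_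
  · filter_upwards [eventually_gt_atTop 0] with t ht
    have ht' : (0 : ℝ) < t := by exact_mod_cast ht
    rw [div_le_div_iff₀ hT' ht']
    exact_mod_cast (key t).1
  · filter_upwards [eventually_gt_atTop 0] with t ht
    have ht' : (0 : ℝ) < t := by exact_mod_cast ht
    rw [div_add_div _ _ hT'.ne' ht'.ne', div_le_div_iff₀ ht' (mul_pos hT' ht')]
    have h : (initialDegree (symbolicPower I t) : ℝ) * T ≤ D * t + D * T := by
      exact_mod_cast (key t).2
    nlinarith [mul_le_mul_of_nonneg_right h ht'.le]

/-- The nodes are `a i = i` and `k j = (2j+1)/2`: doubling them gives the even and odd abscissas of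
the bottom row. -/
theorem standardConfiguration_eq_range [CharZero K] {X : Set (ℙ K (Fin 3 → K))}
    (hX : IsStandardConfiguration K ![1, n + 1, 2 * (n + 1) - 1] X) :
    X = Set.range fun p : PointIndex n => Projectivization.mk K
      (pointVec (fun i : Fin (n + 1) => ((i : ℕ) : K)) (fun j : Fin n => (2 * (j : ℕ) + 1) / 2) p)
      (pointVec_ne_zero p) := by
  rw [hX.2.2]
  ext P
  constructor
  · rintro ⟨i, j, hj, rfl⟩
    fin_cases i
    · have hj0 : j = 0 := by simpa using hj
      subst hj0
      refine ⟨Sum.inl (), ?_⟩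
      simp [affinePoint, pointVec]
    · refine ⟨Sum.inr (Sum.inl ⟨j, by simpa using hj⟩), ?_⟩
      simp [affinePoint, pointVec]
    · have hj' : j < 2 * (n + 1) - 1 := by simpa using hj
      rcases Nat.even_or_odd' j with ⟨m, rfl | rfl⟩
      · refine ⟨Sum.inr (Sum.inr (Sum.inl ⟨m, by omega⟩)), ?_⟩
        simp [affinePoint, pointVec]
      · refine ⟨Sum.inr (Sum.inr (Sum.inr ⟨m, by omega⟩)), ?_⟩
        simp [affinePoint, pointVec, mul_div_cancel₀]
  · rintro ⟨_ | i | i | j, rfl⟩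
    · refine ⟨0, 0, by simp, ?_⟩
      simp [affinePoint, pointVec]
    · refine ⟨1, i, by simpa using i.2, ?_⟩
      simp [affinePoint, pointVec]
    · refine ⟨2, 2 * i, ?_, ?_⟩
      · have := i.2
        simp; omega
      · simp [affinePoint, pointVec]
    · refine ⟨2, 2 * j + 1, ?_, ?_⟩
      · have := j.2
        simp; omega
      · simp [affinePoint, pointVec, mul_div_cancel₀]

end Configuration

end KConfiguration

theorem mainTheorem8 {K : Type*} [Field K] [IsAlgClosed K] [CharZero K] (b : ℕ)
    (X : Set (ℙ K (Fin 3 → K)))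
    (hX : KConfiguration.IsStandardConfiguration K ![1, b, 2 * b - 1] X) :
    KConfiguration.IsWaldschmidtConstant (KConfiguration.pointsIdeal X)
      ((6 * (b : ℝ) ^ 2 - 8 * (b : ℝ) + 1) / (2 * (b : ℝ) ^ 2 - 2 * (b : ℝ))) := by
  have hinf : Infinite K := IsAlgClosed.instInfinite
  have hb : 1 < b := by
    have := hX.2.1 (show (0 : Fin 3) < 1 by decide)
    simpa using this
  obtain ⟨n, rfl⟩ : ∃ n, b = n + 1 := ⟨b - 1, by omega⟩
  have hn : 1 ≤ n := by omega
  rw [KConfiguration.standardConfiguration_eq_range hX, KConfiguration.pointsIdeal_range]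
  have h := KConfiguration.isWaldschmidtConstant_pointsIdeal (K := K) (n := n)
    (a := fun i : Fin (n + 1) => ((i : ℕ) : K)) (k := fun j : Fin n => (2 * (j : ℕ) + 1) / 2) hn
    (fun i j hij => Fin.ext (Nat.cast_injective hij))
    (fun i j hij => by
      have h2 : (2 : K) ≠ 0 := two_ne_zero
      have h1 : (2 * (i : ℕ) + 1 : K) = 2 * (j : ℕ) + 1 := by
        field_simp at hij
        exact hij
      have h3 : 2 * (i : ℕ) + 1 = 2 * (j : ℕ) + 1 := by exact_mod_cast h1
      exact Fin.ext (by omega))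
    (fun i j hij => by
      have h1 : (2 * (i : ℕ) : K) = 2 * (j : ℕ) + 1 := by
        have h2 : (2 : K) ≠ 0 := two_ne_zero
        rw [eq_div_iff h2] at hij
        rw [← hij, mul_comm]
      have h3 : 2 * (i : ℕ) = 2 * (j : ℕ) + 1 := by exact_mod_cast h1
      omega)
  convert h using 2
  · rw [Nat.cast_sub (by nlinarith)]
    push_cast
    ring
  · push_cast
    ring
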